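/- Let $M\ge 0$ be an integer. For $L>0$ let $H^1(0,L)_{\mathrm{per}}$ be the space of absolutely continuous functions $u$ on $[0,L]$ with $u'\in L_2(0,L)$ and $u(L)=u(0)$. For $\beta>0$ let $K_1(\beta)$ be the sharp (smallest) constant such that for all $\alpha>0$ and all real-valued $u\in H^1(0,2\pi/\alpha)_{\mathrm{per}}$ $$\|u\|_\infty^2\le K_1(\beta)\Bigl(\int_0^{2\pi/\alpha}\bigl(u'(x)^2+\alpha^2\beta u(x)^2\bigr)dx\Bigr)^{1/2}\Bigl(\int_0^{2\pi/\alpha}u(x)^2dx\Bigr)^{1/2},$$ and for $0\le\delta<1$ let $K_2(\delta)$ be the sharp constant such that for all real-valued $u\in H^1(0,2\pi)_{\mathrm{per}}$ with $\int_0^{2\pi}u\,dx=0$ $$\|u\|_\infty^2\le K_2(\delta)\Bigl(\int_0^{2\pi}\bigl(u'(x)^2-\delta u(x)^2\bigr)dx\Bigr)^{1/2}\Bigl(\int_0^{2\pi}u(x)^2dx\Bigr)^{1/2}.$$ **Theorem.** (1) Let $\alpha>0$, $\beta>0$, and let $V$ be a measurable function on $(0,2\pi/\alpha)$ whose values are (almost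 everywhere) positive semidefinite Hermitian $M\times M$ matrices, with $\mathrm{Tr}\,V^{3/2}\in L_1(0,2\pi/\alpha)$. Then the operator $$H_1(\beta)=-\frac{d^2}{dx^2}+\alpha^2\beta-V(x)$$ with periodic boundary conditions, acting in $L_2((0,2\pi/\alpha);\mathbb{C}^M)$ and defined through its quadratic form on $H^1(0,2\pi/\alpha)_{\mathrm{per}}$, has discrete spectrum (its spectrum consists of isolated eigenvalues of finite multiplicity), and its negative eigenvalues $-\lambda_j$, counted with multiplicity, satisfy $$\sum_j\lambda_j\le\frac{2}{3\sqrt3}\,K_1(\beta)\int_0^{2\pi/\alpha}\mathrm{Tr}\,[V(x)^{3/2}]\,dx.$$ (2) Let $0\le\delta<1$, and let $V$ be a measurable function on $(0,2\pi)$ whose values are (almost everywhere) positive semidefinite Hermitian $M\times M$ matrices, with $\mathrm{Tr}\,V^{3/2}\in L_1(0,2\pi)$. Let $(\mathrm{P}\psi)(x)=\psi(x)-\frac1{2\pi}\int_0^{2\pi}\psi(t)\,dt$, componentwise. Then the operator $$H_2(\delta)=-\frac{d^2}{dx^2}-\delta-\mathrm{P}(V(x)\mathrm{P}\,\cdot)$$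 with periodic boundary conditions, acting in the space of functions in $L_2((0,2\pi);\mathbb{C}^M)$ with zero mean and defined through its quadratic form on the mean-zero functions of $H^1(0,2\pi)_{\mathrm{per}}$, has discrete spectrum, and its negative eigenvalues $-\mu_j$, counted with multiplicity, satisfy $$\sum_j\mu_j\le\frac{2}{3\sqrt3}\,K_2(\delta)\int_0^{2\pi}\mathrm{Tr}\,[V(x)^{3/2}]\,dx.$$ -/

import Mathlib

open MeasureTheory Set
open scoped ENNReal InnerProductSpace ComplexOrder

noncomputable section

/-! ### Periodic Sobolev functions on `(0, L)` -/

/-- Lebesgue measure on the period `(0, L)`. -/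
abbrev perMeasure (L : ℝ) : Measure ℝ := volume.restrict (Ioc 0 L)

/-- `u ∈ H¹(0, L)_per` with derivative `u' = g ∈ L₂(0, L)`: the function `u` (given by its
absolutely continuous representative) is a primitive of `g` on `[0, L]`, and `u(L) = u(0)`. -/
structure IsPerH1 {E : Type*} [NormedAddCommGroup E] [NormedSpace ℝ E]
    (L : ℝ) (u g : ℝ → E) : Prop where
  deriv_memLp : MemLp g 2 (perMeasure L)
  eq_primitive : ∀ x ∈ Icc 0 L, u x = u 0 + ∫ t in (0 : ℝ)..x, g t
  periodic : u L = u 0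

/-- The sharp constant `K₁(β)` in
`‖u‖_∞² ≤ K (∫ (u'² + α² β u²))^{1/2} (∫ u²)^{1/2}`, `u ∈ H¹(0, 2π/α)_per`, `α > 0`. -/
def sharpK1 (β : ℝ) : ℝ :=
  sInf {K : ℝ | 0 ≤ K ∧ ∀ α : ℝ, 0 < α → ∀ u u' : ℝ → ℝ, IsPerH1 (2 * Real.pi / α) u u' →
    ∀ x ∈ Icc 0 (2 * Real.pi / α), u x ^ 2 ≤
      K * Real.sqrt (∫ t, (u' t ^ 2 + α ^ 2 * β * u t ^ 2) ∂perMeasure (2 * Real.pi / α)) *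
        Real.sqrt (∫ t, u t ^ 2 ∂perMeasure (2 * Real.pi / α))}

/-- The sharp constant `K₂(δ)` in
`‖u‖_∞² ≤ K (∫ (u'² - δ u²))^{1/2} (∫ u²)^{1/2}`, `u ∈ H¹(0, 2π)_per`, `∫ u = 0`. -/
def sharpK2 (δ : ℝ) : ℝ :=
  sInf {K : ℝ | 0 ≤ K ∧ ∀ u u' : ℝ → ℝ, IsPerH1 (2 * Real.pi) u u' →
    ∫ t, u t ∂perMeasure (2 * Real.pi) = 0 →
    ∀ x ∈ Icc 0 (2 * Real.pi), u x ^ 2 ≤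
      K * Real.sqrt (∫ t, (u' t ^ 2 - δ * u t ^ 2) ∂perMeasure (2 * Real.pi)) *
        Real.sqrt (∫ t, u t ^ 2 ∂perMeasure (2 * Real.pi))}

/-! ### Unbounded operators: resolvent set, spectrum, eigenvalues -/

section Spectral

variable {H : Type*} [NormedAddCommGroup H] [NormedSpace ℂ H]

/-- `z` belongs to the resolvent set of `A` if `A - z : dom A → H` is a bijection with a bounded
inverse `R`. -/
def opResolventSet (A : H →ₗ.[ℂ] H) : Set ℂ :=
  {z | ∃ R : H →L[ℂ] H,
    (∀ f : H, ∃ h : R f ∈ A.domain, A ⟨R f, h⟩ - z • R f = f) ∧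
    ∀ u : A.domain, R (A u - z • (u : H)) = u}

/-- The spectrum of an unbounded operator. -/
def opSpectrum (A : H →ₗ.[ℂ] H) : Set ℂ := (opResolventSet A)ᶜ

/-- The space of all `u ∈ dom A` with `A u = z u`. -/
def opEigenspace (A : H →ₗ.[ℂ] H) (z : ℂ) : Submodule ℂ H :=
  A.graph.comap (LinearMap.prod LinearMap.id (z • LinearMap.id))

/-- The spectrum consists of isolated eigenvalues of finite multiplicity. -/
def HasDiscreteSpectrum (A : H →ₗ.[ℂ] H) : Prop :=
  ∀ z ∈ opSpectrum A,
    (∃ ε > 0, ∀ w ∈ opSpectrum A, ‖w - z‖ < ε → w = z) ∧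
    opEigenspace A z ≠ ⊥ ∧ FiniteDimensional ℂ (opEigenspace A z)

/-- The sum of the absolute values of the negative eigenvalues of `A`, each counted with its
multiplicity. -/
def negEigenvalueSum (A : H →ₗ.[ℂ] H) : ℝ≥0∞ :=
  ∑' e : {e : ℝ // e < 0 ∧ opEigenspace A (e : ℂ) ≠ ⊥},
    (Module.finrank ℂ (opEigenspace A ((e : ℝ) : ℂ)) : ℝ≥0∞) * ENNReal.ofReal (-(e : ℝ))

end Spectral

/-! ### The two Schrödinger operators -/

/-- `ℂ^M`. -/
abbrev CVec (M : ℕ) : Type := EuclideanSpace ℂ (Fin M)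

/-- `L₂(0, L)` with values in `ℂ^M`. -/
abbrev VecL2 (M : ℕ) (L : ℝ) : Type := Lp (CVec M) 2 (perMeasure L)

/-- The matrix `A` applied to the vector `v`. -/
abbrev matApply {M : ℕ} (A : Matrix (Fin M) (Fin M) ℂ) (v : CVec M) : CVec M :=
  Matrix.toEuclideanLin A v

/-- `(Pψ)(x) = ψ(x) - (1/2π) ∫₀^{2π} ψ(t) dt`, componentwise. -/
def meanFree {M : ℕ} (u : ℝ → CVec M) : ℝ → CVec M :=
  fun x => u x - (2 * Real.pi)⁻¹ • ∫ t, u t ∂perMeasure (2 * Real.pi)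

/-- `Tr V^{3/2}` for a positive semidefinite matrix `V`. -/
def traceRpow {M : ℕ} (A : Matrix (Fin M) (Fin M) ℂ) : ℝ :=
  (cfc (fun t : ℝ => t ^ (3 / 2 : ℝ)) A).trace.re

namespace IsPerH1

variable {E : Type*} [NormedAddCommGroup E] [NormedSpace ℝ E] {L : ℝ} {u g w h : ℝ → E}

lemma integrable_deriv (hu : IsPerH1 L u g) : Integrable g (perMeasure L) :=
  hu.deriv_memLp.integrable one_le_two

lemma intervalIntegrable (hu : IsPerH1 L u g) {x : ℝ} (hx : x ∈ Icc 0 L) :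
    IntervalIntegrable g volume 0 x := by
  rw [intervalIntegrable_iff_integrableOn_Ioc_of_le hx.1]
  exact IntegrableOn.mono_set (t := Ioc 0 L) hu.integrable_deriv (Ioc_subset_Ioc_right hx.2)

lemma continuousOn (hu : IsPerH1 L u g) : ContinuousOn u (Icc 0 L) := by
  rcases lt_or_ge L 0 with hL | hL
  · rw [Icc_eq_empty (not_le.2 hL)]; exact continuousOn_empty _
  · have h0 : IntegrableOn g (uIcc 0 L) volume := by
      rw [uIcc_of_le hL, integrableOn_Icc_iff_integrableOn_Ioc]; exact hu.integrable_deriv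
    have h1 := intervalIntegral.continuousOn_primitive_interval h0
    rw [uIcc_of_le hL] at h1
    exact (continuousOn_const.add h1).congr hu.eq_primitive

lemma memLp (hu : IsPerH1 L u g) : MemLp u 2 (perMeasure L) := by
  have hm : AEStronglyMeasurable u (perMeasure L) :=
    (hu.continuousOn.mono Ioc_subset_Icc_self).aestronglyMeasurable measurableSet_Ioc
  obtain ⟨C, hC⟩ := isCompact_Icc.exists_bound_of_continuousOn hu.continuousOn
  refine MemLp.of_bound hm C ?_
  filter_upwards [ae_restrict_mem measurableSet_Ioc] with x hx
  exact hC x (Ioc_subset_Icc_self hx)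

lemma integrable (hu : IsPerH1 L u g) : Integrable u (perMeasure L) :=
  hu.memLp.integrable one_le_two

lemma const (c : E) : IsPerH1 L (fun _ => c) (fun _ => 0) :=
  ⟨MemLp.zero, by simp, rfl⟩

lemma add (hu : IsPerH1 L u g) (hw : IsPerH1 L w h) :
    IsPerH1 L (fun x => u x + w x) (fun x => g x + h x) := by
  refine ⟨hu.deriv_memLp.add hw.deriv_memLp, fun x hx => ?_, ?_⟩
  · rw [intervalIntegral.integral_add (hu.intervalIntegrable hx) (hw.intervalIntegrable hx),
      hu.eq_primitive x hx, hw.eq_primitive x hx]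
    abel
  · rw [hu.periodic, hw.periodic]

lemma const_smul {E : Type*} [NormedAddCommGroup E] [NormedSpace ℝ E] [NormedSpace ℂ E]
    [SMulCommClass ℝ ℂ E] {L : ℝ} {u g : ℝ → E} (c : ℂ) (hu : IsPerH1 L u g) :
    IsPerH1 L (fun x => c • u x) (fun x => c • g x) := by
  refine ⟨hu.deriv_memLp.const_smul c, fun x hx => ?_, ?_⟩
  · rw [intervalIntegral.integral_smul, hu.eq_primitive x hx, smul_add]
  · rw [hu.periodic]

/-- A periodic `H¹` function that vanishes almost everywhere vanishes on `[0, L]`. -/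
lemma eq_zero (hL : 0 < L) (hu : IsPerH1 L u g) (h0 : u =ᵐ[perMeasure L] 0) :
    ∀ x ∈ Icc 0 L, u x = 0 := by
  have h1 : ∀ x ∈ Ioo 0 L, u x = 0 := by
    have h2 : u =ᵐ[volume.restrict (Ioo 0 L)] 0 :=
      ae_restrict_of_ae_restrict_of_subset Ioo_subset_Ioc_self h0
    exact Measure.eqOn_open_of_ae_eq h2 isOpen_Ioo
      (hu.continuousOn.mono Ioo_subset_Icc_self) continuousOn_const
  have h3 : EqOn u 0 (closure (Ioo 0 L)) :=
    (show EqOn u 0 (Ioo 0 L) from h1).of_subset_closure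
      (by rw [closure_Ioo hL.ne]; exact hu.continuousOn) continuousOn_const
      subset_closure subset_rfl
  rw [closure_Ioo hL.ne] at h3
  exact h3

lemma deriv_eq_zero [CompleteSpace E] (hL : 0 < L) (hu : IsPerH1 L u g)
    (h0 : u =ᵐ[perMeasure L] 0) : g =ᵐ[perMeasure L] 0 := by
  have hz := hu.eq_zero hL h0
  have hint := hu.intervalIntegrable (x := L) ⟨hL.le, le_rfl⟩
  have hd := hint.ae_hasDerivAt_integral
  have hb : ∀ᵐ x ∂(volume : Measure ℝ), x ≠ L := by simp [ae_iff]
  refine (ae_restrict_iff' measurableSet_Ioc).2 ?_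
  filter_upwards [hd, hb] with x hx hxL hxm
  have hxo : x ∈ Ioo 0 L := ⟨hxm.1, lt_of_le_of_ne hxm.2 hxL⟩
  have hx1 := hx (by rw [uIcc_of_le hL.le]; exact Ioc_subset_Icc_self hxm) 0
    (by rw [uIcc_of_le hL.le]; exact ⟨le_rfl, hL.le⟩)
  have hev : (fun y => ∫ t in (0 : ℝ)..y, g t) =ᶠ[nhds x] fun _ => 0 := by
    filter_upwards [isOpen_Ioo.mem_nhds hxo] with y hy
    have h4 := hu.eq_primitive y (Ioo_subset_Icc_self hy)
    rw [hz y (Ioo_subset_Icc_self hy), hz 0 ⟨le_rfl, hL.le⟩, zero_add] at h4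
    exact h4.symm
  exact hx1.unique ((hasDerivAt_const x (0 : E)).congr_of_eventuallyEq hev)

end IsPerH1

lemma integrable_inner_of_memLp {M : ℕ} {L : ℝ} {f g : ℝ → CVec M}
    (hf : MemLp f 2 (perMeasure L)) (hg : MemLp g 2 (perMeasure L)) :
    Integrable (fun x => ⟪f x, g x⟫_ℂ) (perMeasure L) := by
  refine (L2.integrable_inner (𝕜 := ℂ) hf.toLp hg.toLp).congr ?_
  filter_upwards [hf.coeFn_toLp, hg.coeFn_toLp] with x h1 h2
  rw [h1, h2]

/-- A function orthogonal to all mean-zero periodic `H¹` functions is constant. -/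
lemma ae_const_of_forall_integral_inner_eq_zero {M : ℕ} {L : ℝ} (hL : 0 < L) {f : ℝ → CVec M}
    (hf : Integrable f (perMeasure L))
    (h : ∀ v v' : ℝ → CVec M, IsPerH1 L v v' → ∫ t, v t ∂perMeasure L = 0 →
      ∫ x, ⟪v x, f x⟫_ℂ ∂perMeasure L = 0) :
    f =ᵐ[perMeasure L] fun _ => L⁻¹ • ∫ t, f t ∂perMeasure L := by
  set c : CVec M := L⁻¹ • ∫ t, f t ∂perMeasure L with hc
  have key : ∀ᵐ x ∂(volume : Measure ℝ), x ∈ Ioo 0 L → (fun x => f x - c) x = 0 := by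
    refine isOpen_Ioo.ae_eq_zero_of_integral_contDiff_smul_eq_zero ?_ ?_
    · have h1 : IntegrableOn (fun x => f x - c) (Ioc 0 L) volume := hf.sub (integrable_const c)
      exact (h1.mono_set Ioo_subset_Ioc_self).locallyIntegrableOn
    · intro g hg hgc hgs
      have hgz : ∀ x, x ∉ Ioo 0 L → g x = 0 := fun x hx =>
        image_eq_zero_of_notMem_tsupport fun hx' => hx (hgs hx')
      have hgcont : Continuous g := hg.continuous
      have hdc : Continuous (deriv g) := hg.continuous_deriv (by simp)
      have hgi : Integrable g (perMeasure L) :=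
        (hgcont.integrable_of_hasCompactSupport hgc).mono_measure Measure.restrict_le_self
      obtain ⟨C, hC⟩ := hgc.exists_bound_of_continuous hgcont
      set m : ℝ := L⁻¹ * ∫ t, g t ∂perMeasure L with hm
      have hgf : Integrable (fun x => g x • f x) (perMeasure L) :=
        hf.bdd_smul C hgcont.aestronglyMeasurable (Filter.Eventually.of_forall hC)
      have hmf : Integrable (fun x => m • f x) (perMeasure L) := hf.smul m
      have h2 : ∫ x, (g x - m) • f x ∂perMeasure L = 0 := by
        refine ext_inner_left ℂ fun e => ?_
        rw [inner_zero_right]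
        have hv : IsPerH1 L (fun x => (g x - m) • e) (fun x => deriv g x • e) := by
          refine ⟨?_, fun x _ => ?_, ?_⟩
          · obtain ⟨D, hD⟩ := hgc.deriv.exists_bound_of_continuous hdc
            refine MemLp.of_bound (hdc.smul continuous_const).aestronglyMeasurable (D * ‖e‖) ?_
            refine Filter.Eventually.of_forall fun x => ?_
            rw [norm_smul]
            exact mul_le_mul_of_nonneg_right (hD x) (norm_nonneg _)
          · have h3 : ∫ t in (0 : ℝ)..x, deriv g t • e = (g x - g 0) • e := by
              rw [intervalIntegral.integral_smul_const,
                intervalIntegral.integral_deriv_eq_sub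
                  (fun y _ => (hg.differentiable (by simp)).differentiableAt)
                  (hdc.intervalIntegrable _ _)]
            rw [h3, ← add_smul]
            congr 1
            ring
          · simp [hgz 0 (by simp), hgz L (by simp)]
        have hv0 : ∫ t, (g t - m) • e ∂perMeasure L = 0 := by
          rw [integral_smul_const, integral_sub hgi (integrable_const m)]
          have : ∫ _t, m ∂perMeasure L = ∫ t, g t ∂perMeasure L := by
            rw [hm]
            simp [hL.le, mul_inv_cancel_left₀ hL.ne']
          rw [this, sub_self, zero_smul]
        have h4 := h _ _ hv hv0
        rw [← integral_inner (by simp only [sub_smul]; exact hgf.sub hmf), ← h4]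
        refine integral_congr_ae (Filter.Eventually.of_forall fun x => ?_)
        simp only [← Complex.coe_smul, inner_smul_left, inner_smul_right, Complex.conj_ofReal]
      rw [← setIntegral_eq_integral_of_forall_compl_eq_zero (s := Ioc 0 L)
        (fun x hx => by rw [hgz x fun hx' => hx (Ioo_subset_Ioc_self hx'), zero_smul])]
      change ∫ x, g x • (f x - c) ∂perMeasure L = 0
      simp only [sub_smul] at h2
      rw [integral_sub hgf hmf, integral_smul] at h2
      simp only [smul_sub]
      rw [integral_sub hgf (hgi.smul_const c), integral_smul_const, ← h2, hc, hm, smul_smul,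
        mul_comm]
  have hb : ∀ᵐ x ∂(volume : Measure ℝ), x ≠ L := by simp [ae_iff]
  refine (ae_restrict_iff' measurableSet_Ioc).2 ?_
  filter_upwards [key, hb] with x hx hxL hxm
  exact sub_eq_zero.1 (hx ⟨hxm.1, lt_of_le_of_ne hxm.2 hxL⟩)

/-- The graph of `-d²/dx² + α²β - V` in `L₂(0, 2π/α)`, defined through its quadratic form:
`u ∈ dom` and `H₁u = f` mean that `u ∈ H¹(0, 2π/α)_per` and
`∫ ⟨u', v'⟩ + α²β ∫ ⟨u, v⟩ - ∫ ⟨Vu, v⟩ = ∫ ⟨f, v⟩` for all `v ∈ H¹(0, 2π/α)_per`. -/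
def schrGraph1 {M : ℕ} (α β : ℝ) (V : ℝ → Matrix (Fin M) (Fin M) ℂ) :
    Submodule ℂ (VecL2 M (2 * Real.pi / α) × VecL2 M (2 * Real.pi / α)) where
  carrier := {p | ∃ u u' : ℝ → CVec M, IsPerH1 (2 * Real.pi / α) u u' ∧
    p.1 =ᵐ[perMeasure (2 * Real.pi / α)] u ∧
    ∀ v v' : ℝ → CVec M, IsPerH1 (2 * Real.pi / α) v v' →
      Integrable (fun x => ⟪v x, matApply (V x) (u x)⟫_ℂ) (perMeasure (2 * Real.pi / α)) ∧
      (∫ x, ⟪v' x, u' x⟫_ℂ ∂perMeasure (2 * Real.pi / α)) +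
        ((α ^ 2 * β : ℝ) : ℂ) * (∫ x, ⟪v x, u x⟫_ℂ ∂perMeasure (2 * Real.pi / α)) -
        (∫ x, ⟪v x, matApply (V x) (u x)⟫_ℂ ∂perMeasure (2 * Real.pi / α)) =
      ∫ x, ⟪v x, p.2 x⟫_ℂ ∂perMeasure (2 * Real.pi / α)}
  zero_mem' := by
    refine ⟨fun _ => 0, fun _ => 0, IsPerH1.const 0, Lp.coeFn_zero _ _ _, fun v v' hv => ?_⟩
    have h0 : ∫ x, ⟪v x, ((0 : VecL2 M (2 * Real.pi / α)) : ℝ → CVec M) x⟫_ℂ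
        ∂perMeasure (2 * Real.pi / α) = 0 := by
      refine integral_eq_zero_of_ae ?_
      filter_upwards [Lp.coeFn_zero (CVec M) 2 (perMeasure (2 * Real.pi / α))] with x hx
      rw [hx]; simp
    refine ⟨by simp, ?_⟩
    rw [Prod.snd_zero, h0]
    simp
  add_mem' := by
    rintro p q ⟨u, u', hu, hpu, hp⟩ ⟨w, w', hw, hqw, hq⟩
    refine ⟨_, _, hu.add hw, ?_, fun v v' hv => ?_⟩
    · filter_upwards [Lp.coeFn_add p.1 q.1, hpu, hqw] with x h1 h2 h3
      rw [Prod.fst_add, h1, Pi.add_apply, h2, h3]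
    · obtain ⟨i1, e1⟩ := hp v v' hv
      obtain ⟨i2, e2⟩ := hq v v' hv
      have h0 : ∫ x, ⟪v x, (p + q).2 x⟫_ℂ ∂perMeasure (2 * Real.pi / α) =
          ∫ x, (⟪v x, p.2 x⟫_ℂ + ⟪v x, q.2 x⟫_ℂ) ∂perMeasure (2 * Real.pi / α) := by
        refine integral_congr_ae ?_
        filter_upwards [Lp.coeFn_add p.2 q.2] with x h1
        rw [Prod.snd_add, h1, Pi.add_apply, inner_add_right]
      simp only [map_add, inner_add_right]
      refine ⟨i1.add i2, ?_⟩
      rw [h0, integral_add (integrable_inner_of_memLp hv.memLp (Lp.memLp p.2))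
        (integrable_inner_of_memLp hv.memLp (Lp.memLp q.2)), integral_add i1 i2,
        integral_add (integrable_inner_of_memLp hv.memLp hu.memLp) (integrable_inner_of_memLp hv.memLp hw.memLp),
        integral_add (integrable_inner_of_memLp hv.deriv_memLp hu.deriv_memLp)
          (integrable_inner_of_memLp hv.deriv_memLp hw.deriv_memLp), ← e1, ← e2]
      ring
  smul_mem' := by
    rintro c p ⟨u, u', hu, hpu, hp⟩
    refine ⟨_, _, hu.const_smul c, ?_, fun v v' hv => ?_⟩
    · filter_upwards [Lp.coeFn_smul c p.1, hpu] with x h1 h2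
      rw [Prod.smul_fst, h1, Pi.smul_apply, h2]
    · obtain ⟨i1, e1⟩ := hp v v' hv
      have h0 : ∫ x, ⟪v x, (c • p).2 x⟫_ℂ ∂perMeasure (2 * Real.pi / α) =
          ∫ x, c * ⟪v x, p.2 x⟫_ℂ ∂perMeasure (2 * Real.pi / α) := by
        refine integral_congr_ae ?_
        filter_upwards [Lp.coeFn_smul c p.2] with x h1
        rw [Prod.smul_snd, h1, Pi.smul_apply, inner_smul_right]
      simp only [map_smul, inner_smul_right]
      refine ⟨i1.const_mul c, ?_⟩
      rw [h0]
      simp only [integral_const_mul]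
      rw [← e1]
      ring

/-- The operator `-d²/dx² + α²β - V` acting in `L₂(0, 2π/α)` with periodic boundary conditions. -/
def schrOp1 {M : ℕ} (α β : ℝ) (V : ℝ → Matrix (Fin M) (Fin M) ℂ) :
    VecL2 M (2 * Real.pi / α) →ₗ.[ℂ] VecL2 M (2 * Real.pi / α) :=
  (schrGraph1 α β V).toLinearPMap

/-- `schrGraph1` is the graph of a linear map, and `schrOp1` is this map. -/
lemma schrOp1_graph {M : ℕ} {α : ℝ} (hα : 0 < α) (β : ℝ) (V : ℝ → Matrix (Fin M) (Fin M) ℂ) :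
    (schrOp1 α β V).graph = schrGraph1 α β V := by
  have hL : 0 < 2 * Real.pi / α := by positivity
  refine Submodule.toLinearPMap_graph_eq _ ?_
  rintro ⟨p, f⟩ ⟨u, u', hu, hpu, hp⟩ h0
  simp only at h0 hpu hp ⊢
  subst h0
  have hu0 : u =ᵐ[perMeasure (2 * Real.pi / α)] 0 := hpu.symm.trans (Lp.coeFn_zero _ _ _)
  have hu'0 := hu.deriv_eq_zero hL hu0
  have hf : ∀ v v' : ℝ → CVec M, IsPerH1 (2 * Real.pi / α) v v' →
      ∫ x, ⟪v x, f x⟫_ℂ ∂perMeasure (2 * Real.pi / α) = 0 := by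
    intro v v' hv
    rw [← (hp v v' hv).2, integral_eq_zero_of_ae (hu'0.mono fun x hx => by simp [hx]),
      integral_eq_zero_of_ae (hu0.mono fun x hx => by simp [hx]),
      integral_eq_zero_of_ae (hu0.mono fun x hx => by simp [hx])]
    simp
  have hfi : Integrable f (perMeasure (2 * Real.pi / α)) := (Lp.memLp f).integrable one_le_two
  have hc := ae_const_of_forall_integral_inner_eq_zero hL hfi fun v v' hv _ => hf v v' hv
  have hm : ∫ t, f t ∂perMeasure (2 * Real.pi / α) = 0 := by
    refine ext_inner_left ℂ fun e => ?_
    rw [← integral_inner hfi, hf _ _ (IsPerH1.const e), inner_zero_right]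
  rw [hm, smul_zero] at hc
  exact (Lp.eq_zero_iff_ae_eq_zero).2 hc

/-- `{f ∈ L₂(0, 2π) : ∫₀^{2π} f = 0}`, with values in `ℂ^M`. -/
def MeanZeroL2 (M : ℕ) : Submodule ℂ (VecL2 M (2 * Real.pi)) where
  carrier := {f | ∫ t, f t ∂perMeasure (2 * Real.pi) = 0}
  zero_mem' := by
    refine integral_eq_zero_of_ae ?_
    exact Lp.coeFn_zero _ _ _
  add_mem' := by
    intro f g hf hg
    simp only [mem_ofPred_eq] at hf hg ⊢
    rw [integral_congr_ae (Lp.coeFn_add f g)]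
    simp only [Pi.add_apply]
    rw [integral_add ((Lp.memLp f).integrable one_le_two) ((Lp.memLp g).integrable one_le_two),
      hf, hg, add_zero]
  smul_mem' := by
    intro c f hf
    simp only [mem_ofPred_eq] at hf ⊢
    rw [integral_congr_ae (Lp.coeFn_smul c f)]
    simp only [Pi.smul_apply]
    rw [integral_smul, hf, smul_zero]

lemma meanFree_add {M : ℕ} {u w : ℝ → CVec M} (hu : Integrable u (perMeasure (2 * Real.pi)))
    (hw : Integrable w (perMeasure (2 * Real.pi))) (x : ℝ) :
    meanFree (fun x => u x + w x) x = meanFree u x + meanFree w x := by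
  simp only [meanFree]
  rw [integral_add hu hw, smul_add]
  abel

lemma meanFree_smul {M : ℕ} (c : ℂ) (u : ℝ → CVec M) (x : ℝ) :
    meanFree (fun x => c • u x) x = c • meanFree u x := by
  simp only [meanFree]
  rw [integral_smul, smul_sub, smul_comm c]

/-- The graph of `-d²/dx² - δ - P(V P ·)` in the space of mean-zero functions, defined through its
quadratic form: `u ∈ dom` and `H₂u = f` mean that `u ∈ H¹(0, 2π)_per` and
`∫ ⟨u', v'⟩ - δ ∫ ⟨u, v⟩ - ∫ ⟨V P u, P v⟩ = ∫ ⟨f, v⟩` for all `v ∈ H¹(0, 2π)_per` with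
`∫ v = 0`. -/
def schrGraph2 {M : ℕ} (δ : ℝ) (V : ℝ → Matrix (Fin M) (Fin M) ℂ) :
    Submodule ℂ (MeanZeroL2 M × MeanZeroL2 M) where
  carrier := {p | ∃ u u' : ℝ → CVec M, IsPerH1 (2 * Real.pi) u u' ∧
    (p.1 : VecL2 M (2 * Real.pi)) =ᵐ[perMeasure (2 * Real.pi)] u ∧
    ∀ v v' : ℝ → CVec M, IsPerH1 (2 * Real.pi) v v' → ∫ t, v t ∂perMeasure (2 * Real.pi) = 0 →
      Integrable (fun x => ⟪meanFree v x, matApply (V x) (meanFree u x)⟫_ℂ)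
        (perMeasure (2 * Real.pi)) ∧
      (∫ x, ⟪v' x, u' x⟫_ℂ ∂perMeasure (2 * Real.pi)) -
        (δ : ℂ) * (∫ x, ⟪v x, u x⟫_ℂ ∂perMeasure (2 * Real.pi)) -
        (∫ x, ⟪meanFree v x, matApply (V x) (meanFree u x)⟫_ℂ ∂perMeasure (2 * Real.pi)) =
      ∫ x, ⟪v x, (p.2 : VecL2 M (2 * Real.pi)) x⟫_ℂ ∂perMeasure (2 * Real.pi)}
  zero_mem' := by
    refine ⟨fun _ => 0, fun _ => 0, IsPerH1.const 0, Lp.coeFn_zero _ _ _, fun v v' hv _ => ?_⟩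
    have h0 : ∫ x, ⟪v x, ((0 : VecL2 M (2 * Real.pi)) : ℝ → CVec M) x⟫_ℂ
        ∂perMeasure (2 * Real.pi) = 0 := by
      refine integral_eq_zero_of_ae ?_
      filter_upwards [Lp.coeFn_zero (CVec M) 2 (perMeasure (2 * Real.pi))] with x hx
      rw [hx]; simp
    have h1 : ∀ x, meanFree (fun _ => (0 : CVec M)) x = 0 := by simp [meanFree]
    refine ⟨by simp [h1], ?_⟩
    rw [Prod.snd_zero, ZeroMemClass.coe_zero, h0]
    simp [h1]
  add_mem' := by
    rintro p q ⟨u, u', hu, hpu, hp⟩ ⟨w, w', hw, hqw, hq⟩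
    refine ⟨_, _, hu.add hw, ?_, fun v v' hv hv0 => ?_⟩
    · filter_upwards [Lp.coeFn_add (p.1 : VecL2 M (2 * Real.pi)) q.1, hpu, hqw] with x h1 h2 h3
      rw [Prod.fst_add, Submodule.coe_add, h1, Pi.add_apply, h2, h3]
    · obtain ⟨i1, e1⟩ := hp v v' hv hv0
      obtain ⟨i2, e2⟩ := hq v v' hv hv0
      have h0 : ∫ x, ⟪v x, ((p + q).2 : VecL2 M (2 * Real.pi)) x⟫_ℂ ∂perMeasure (2 * Real.pi) =
          ∫ x, (⟪v x, (p.2 : VecL2 M (2 * Real.pi)) x⟫_ℂ +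
            ⟪v x, (q.2 : VecL2 M (2 * Real.pi)) x⟫_ℂ) ∂perMeasure (2 * Real.pi) := by
        refine integral_congr_ae ?_
        filter_upwards [Lp.coeFn_add (p.2 : VecL2 M (2 * Real.pi)) q.2] with x h1
        rw [Prod.snd_add, Submodule.coe_add, h1, Pi.add_apply, inner_add_right]
      simp only [meanFree_add hu.integrable hw.integrable, map_add, inner_add_right]
      refine ⟨i1.add i2, ?_⟩
      rw [h0, integral_add (integrable_inner_of_memLp hv.memLp (Lp.memLp _))
        (integrable_inner_of_memLp hv.memLp (Lp.memLp _)), integral_add i1 i2,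
        integral_add (integrable_inner_of_memLp hv.memLp hu.memLp)
          (integrable_inner_of_memLp hv.memLp hw.memLp),
        integral_add (integrable_inner_of_memLp hv.deriv_memLp hu.deriv_memLp)
          (integrable_inner_of_memLp hv.deriv_memLp hw.deriv_memLp), ← e1, ← e2]
      ring
  smul_mem' := by
    rintro c p ⟨u, u', hu, hpu, hp⟩
    refine ⟨_, _, hu.const_smul c, ?_, fun v v' hv hv0 => ?_⟩
    · filter_upwards [Lp.coeFn_smul c (p.1 : VecL2 M (2 * Real.pi)), hpu] with x h1 h2
      rw [Prod.smul_fst, Submodule.coe_smul, h1, Pi.smul_apply, h2]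
    · obtain ⟨i1, e1⟩ := hp v v' hv hv0
      have h0 : ∫ x, ⟪v x, ((c • p).2 : VecL2 M (2 * Real.pi)) x⟫_ℂ ∂perMeasure (2 * Real.pi) =
          ∫ x, c * ⟪v x, (p.2 : VecL2 M (2 * Real.pi)) x⟫_ℂ ∂perMeasure (2 * Real.pi) := by
        refine integral_congr_ae ?_
        filter_upwards [Lp.coeFn_smul c (p.2 : VecL2 M (2 * Real.pi))] with x h1
        rw [Prod.smul_snd, Submodule.coe_smul, h1, Pi.smul_apply, inner_smul_right]
      simp only [meanFree_smul, map_smul, inner_smul_right]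
      refine ⟨i1.const_mul c, ?_⟩
      rw [h0]
      simp only [integral_const_mul]
      rw [← e1]
      ring

/-- The operator `-d²/dx² - δ - P(V P ·)` acting in the mean-zero functions of `L₂(0, 2π)` with
periodic boundary conditions. -/
def schrOp2 {M : ℕ} (δ : ℝ) (V : ℝ → Matrix (Fin M) (Fin M) ℂ) :
    MeanZeroL2 M →ₗ.[ℂ] MeanZeroL2 M :=
  (schrGraph2 δ V).toLinearPMap

/-- `schrGraph2` is the graph of a linear map, and `schrOp2` is this map. -/
lemma schrOp2_graph {M : ℕ} (δ : ℝ) (V : ℝ → Matrix (Fin M) (Fin M) ℂ) :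
    (schrOp2 δ V).graph = schrGraph2 δ V := by
  have hL : 0 < 2 * Real.pi := by positivity
  refine Submodule.toLinearPMap_graph_eq _ ?_
  rintro ⟨p, f⟩ ⟨u, u', hu, hpu, hp⟩ h0
  simp only at h0 hpu hp ⊢
  subst h0
  have hu0 : u =ᵐ[perMeasure (2 * Real.pi)] 0 := hpu.symm.trans (Lp.coeFn_zero _ _ _)
  have hu'0 := hu.deriv_eq_zero hL hu0
  have hi0 : ∫ t, u t ∂perMeasure (2 * Real.pi) = 0 := integral_eq_zero_of_ae hu0
  have hm0 : meanFree u =ᵐ[perMeasure (2 * Real.pi)] 0 :=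
    hu0.mono fun x hx => by simp only [meanFree, hi0, hx]; simp
  have hf : ∀ v v' : ℝ → CVec M, IsPerH1 (2 * Real.pi) v v' →
      ∫ t, v t ∂perMeasure (2 * Real.pi) = 0 →
      ∫ x, ⟪v x, (f : VecL2 M (2 * Real.pi)) x⟫_ℂ ∂perMeasure (2 * Real.pi) = 0 := by
    intro v v' hv hv0
    rw [← (hp v v' hv hv0).2, integral_eq_zero_of_ae (hu'0.mono fun x hx => by simp [hx]),
      integral_eq_zero_of_ae (hu0.mono fun x hx => by simp [hx]),
      integral_eq_zero_of_ae (hm0.mono fun x hx => by simp [hx])]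
    simp
  have hc := ae_const_of_forall_integral_inner_eq_zero hL
    ((Lp.memLp (f : VecL2 M (2 * Real.pi))).integrable one_le_two) hf
  have hm : ∫ t, (f : VecL2 M (2 * Real.pi)) t ∂perMeasure (2 * Real.pi) = 0 := f.2
  rw [hm, smul_zero] at hc
  exact Subtype.ext ((Lp.eq_zero_iff_ae_eq_zero).2 hc)

end

/-! Both operators come from a form `b(v, u) = ∫⟨v', u'⟩ + c ∫⟨v, u⟩ - ∫⟨v, V u⟩` with `c = α²β` or
`c = -δ`. Integrability of `Tr V^{3/2}` makes the norm of `V` integrable, and in one dimension such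
a potential is controlled by `ε ∫|u'|² + C_ε ∫|u|²`. The form is therefore bounded and, after a
shift, coercive on periodic `H¹` (`exists_coercive`). As `H¹` embeds compactly into `L₂`
(`isCompactOperator_toL2`), a shifted operator has a compact symmetric inverse
(`exists_compact_resolvent`), and the spectrum is discrete (`hasDiscreteSpectrum_of_graph`).

For the eigenvalue bound, take orthonormal eigenfunctions `ψ_i`, fix `x`, and diagonalise the
density matrix `U = ∑ ⟨ψ_i(x), ·⟩ ψ_i(x)` on `ℂ^M`: `U b_k = μ_k b_k`. The function `F_k(t) = ∑
⟨ψ_i(x), b_k⟩ ψ_i(t)` satisfies `F_k(x) = μ_k b_k` and, by orthonormality, `‖F_k‖² = μ_k`. The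
scalar interpolation inequality for `Re⟨b_k, F_k⟩` at `x` then reads `μ_k³ ≤ K² E_k`, with `E_k` the
potential-free energy of `F_k` (`cube_le_of_isInterpConst`). With `v_k = ⟨b_k, V(x) b_k⟩`, Young's
inequality gives `μ_k v_k ≤ E_k + 2/(3√3) K v_k^{3/2}` (`mul_le_add_rpow_of_cube_le`).

Summed over `k`, the left side is `∑ ⟨ψ_i(x), V(x) ψ_i(x)⟩`, and Peierls' inequality bounds `∑
v_k^{3/2}` by `Tr V(x)^{3/2}` (`sum_re_inner_matApply_le`). Integrated over `x`, `∑ E_k` becomes the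
sum of the potential-free energies of the `ψ_i`, again by orthonormality. Rearranging gives the
bound on `-∑ e_i`. Each `F_k` is a linear combination of the `ψ_i`, so the mean-zero condition is
inherited and the same argument serves `K₂`; there Wirtinger's inequality supplies nonnegativity of
the energy. -/

open MeasureTheory Set
open scoped ENNReal InnerProductSpace ComplexOrder

noncomputable section

/-! ### Operators with compact resolvent -/

section Abstract

open Module End

variable {H : Type*} [NormedAddCommGroup H] [InnerProductSpace ℂ H]

/-- A nonzero point is not an accumulation point of eigenvalues of a compact symmetric operator. -/
lemma IsCompactOperator.exists_forall_not_hasEigenvalue {T : H →L[ℂ] H} (hT : IsCompactOperator T)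
    (hs : (T : H →ₗ[ℂ] H).IsSymmetric) {t : ℂ} (ht : t ≠ 0) :
    ∃ ε > 0, ∀ s : ℂ, ‖s - t‖ < ε → s ≠ t → ¬ HasEigenvalue (T : End ℂ H) s := by
  -- On the complement of the `t`-eigenspace `T` no longer has the eigenvalue `t`, so by compactness
  -- `T - t` is bounded below there. By symmetry, eigenvectors for any `s ≠ t` lie in this
  -- complement.
  set E : Submodule ℂ H := (eigenspace (T : End ℂ H) t)ᗮ with hE
  have hinv : ∀ v ∈ E, (T : H →ₗ[ℂ] H) v ∈ E := fun v hv =>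
    hs.invariant_orthogonalComplement_eigenspace t v hv
  have hEc : IsClosed (E : Set H) := Submodule.isClosed_orthogonal _
  have hTr : IsCompactOperator ((T : H →ₗ[ℂ] H).restrict hinv) :=
    IsCompactOperator.restrict (f := (T : H →ₗ[ℂ] H)) hT hinv hEc
  let T' : E →L[ℂ] E := ⟨(T : H →ₗ[ℂ] H).restrict hinv, hTr.continuous⟩
  have hne : ¬ HasEigenvalue (T' : End ℂ E) t := by
    intro h
    obtain ⟨x, hx⟩ := h.exists_hasEigenvector
    have h1 : T' x = t • x := hx.apply_eq_smul
    have h2 : (x : H) ∈ eigenspace (T : End ℂ H) t := by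
      rw [mem_eigenspace_iff]
      exact congrArg Subtype.val h1
    have h3 : ⟪(x : H), x⟫_ℂ = 0 := Submodule.inner_right_of_mem_orthogonal h2 x.2
    exact hx.2 (Subtype.ext (inner_self_eq_zero.1 h3))
  obtain ⟨K, hK⟩ := IsCompactOperator.antilipschitz_of_not_hasEigenvalue (T := T') hTr ht hne
  -- An eigenvector `y` for `s` would give `‖y‖ ≤ K ‖s - t‖ ‖y‖`. The radius uses `K + 1` because
  -- `K` may vanish.
  refine ⟨(K + 1 : ℝ)⁻¹, by positivity, fun s hst hne' hs' => ?_⟩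
  obtain ⟨y, hy⟩ := hs'.exists_hasEigenvector
  have hyE : y ∈ E := by
    rw [hE, Submodule.mem_orthogonal]
    intro u hu
    have := hs.orthogonalFamily_eigenspaces.pairwise hne'.symm
    exact inner_eq_zero_symm.1 (this hu y hy.1)
  have h1 : T y = s • y := hy.apply_eq_smul
  have h2 : (T' - t • 1 : E →L[ℂ] E) ⟨y, hyE⟩ = (s - t) • ⟨y, hyE⟩ := by
    apply Subtype.ext
    change T y - t • y = (s - t) • y
    rw [h1, sub_smul]
  have h3 := hK.le_mul_dist ⟨y, hyE⟩ 0
  rw [map_zero, dist_zero_right, dist_zero_right, h2, norm_smul] at h3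
  have h4 : 0 < ‖(⟨y, hyE⟩ : E)‖ := norm_pos_iff.2 fun h => hy.2 (congrArg Subtype.val h)
  have h5 : ‖s - t‖ * (K + 1) < 1 := by
    have := mul_lt_mul_of_pos_right hst (show (0 : ℝ) < K + 1 by positivity)
    rwa [inv_mul_cancel₀ (by positivity)] at this
  have h6 : (K : ℝ) * ‖s - t‖ < 1 := by nlinarith [norm_nonneg (s - t)]
  nlinarith

lemma mem_opEigenspace {A : H →ₗ.[ℂ] H} {z : ℂ} {w : H} :
    w ∈ opEigenspace A z ↔ (w, z • w) ∈ A.graph := Iff.rfl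

lemma mem_opSpectrum_of_opEigenspace_ne_bot {A : H →ₗ.[ℂ] H} {z : ℂ}
    (h : opEigenspace A z ≠ ⊥) : z ∈ opSpectrum A := by
  rintro ⟨R, -, hR⟩
  refine h ((Submodule.eq_bot_iff _).2 fun w hw => ?_)
  obtain ⟨u, hu, hu'⟩ := A.mem_graph_iff.1 (mem_opEigenspace.1 hw)
  simp only at hu hu'
  have := hR u
  rw [hu', hu, sub_self, map_zero] at this
  exact this.symm

/-- A sum of nonnegative terms is bounded once its finite partial sums are. A finite set of negative
eigenvalues yields a finite orthonormal family of eigenvectors: orthonormal bases of the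
eigenspaces, which are mutually orthogonal by symmetry. -/
lemma negEigenvalueSum_le {A : H →ₗ.[ℂ] H} (hA : HasDiscreteSpectrum A)
    (hs : ∀ p ∈ A.graph, ∀ q ∈ A.graph, ⟪p.1, q.2⟫_ℂ = ⟪p.2, q.1⟫_ℂ) {C : ℝ}
    (h : ∀ (ι : Type) [Fintype ι] (w : ι → H) (e : ι → ℝ), Orthonormal ℂ w →
      (∀ i, (w i, (e i : ℂ) • w i) ∈ A.graph) → ∑ i, -e i ≤ C) :
    negEigenvalueSum A ≤ ENNReal.ofReal C := by
  classical
  refine ENNReal.summable.tsum_le_of_sum_le fun s => ?_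
  have hfin : ∀ e : s, FiniteDimensional ℂ (opEigenspace A ((e : ℝ) : ℂ)) := fun e =>
    (hA _ (mem_opSpectrum_of_opEigenspace_ne_bot e.1.2.2)).2.2
  have horth : OrthogonalFamily ℂ (fun e : s => opEigenspace A ((e : ℝ) : ℂ))
      fun e => (opEigenspace A ((e : ℝ) : ℂ)).subtypeₗᵢ := by
    intro e e' hne v w
    change ⟪(v : H), (w : H)⟫_ℂ = 0
    have h1 := hs _ (mem_opEigenspace.1 v.2) _ (mem_opEigenspace.1 w.2)
    simp only [inner_smul_left, inner_smul_right, Complex.conj_ofReal] at h1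
    have h2 : ((e : ℝ) : ℂ) ≠ ((e' : ℝ) : ℂ) := fun h =>
      hne (Subtype.ext (Subtype.ext (Complex.ofReal_injective h)))
    by_contra h3
    exact h2 (mul_right_cancel₀ h3 h1).symm
  let ob : ∀ e : s, OrthonormalBasis (Fin (Module.finrank ℂ (opEigenspace A ((e : ℝ) : ℂ)))) ℂ
    (opEigenspace A ((e : ℝ) : ℂ)) := fun e => stdOrthonormalBasis ℂ _
  have hon := horth.orthonormal_sigma_orthonormal (v_family := fun e => ob e)
    fun e => (ob e).orthonormal
  have h1 := h _ _ (fun i => ((i.1 : ℝ))) hon fun i => mem_opEigenspace.1 (ob i.1 i.2).2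
  rw [Fintype.sum_sigma] at h1
  simp only [Finset.sum_const, Finset.card_univ, Fintype.card_fin] at h1
  calc _ = ∑ e : s, (Module.finrank ℂ (opEigenspace A ((e : ℝ) : ℂ)) : ℝ≥0∞) *
        ENNReal.ofReal (-(e : ℝ)) := (Finset.sum_coe_sort s _).symm
    _ = ENNReal.ofReal (∑ e : s, Module.finrank ℂ (opEigenspace A ((e : ℝ) : ℂ)) • (-(e : ℝ))) := by
        rw [ENNReal.ofReal_sum_of_nonneg]
        · refine Finset.sum_congr rfl fun e _ => ?_
          rw [ENNReal.ofReal_nsmul, nsmul_eq_mul]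
        · intro e _
          exact nsmul_nonneg (neg_nonneg.2 e.1.2.1.le) _
    _ ≤ _ := ENNReal.ofReal_le_ofReal h1

variable [CompleteSpace H]

/-- The hypothesis on the graph says `T = (A + l)⁻¹`. The spectral theory of compact symmetric
operators is transported through `z ↦ (z + l)⁻¹`. -/
lemma hasDiscreteSpectrum_of_graph {A : H →ₗ.[ℂ] H} {T : H →L[ℂ] H} (hT : IsCompactOperator T)
    (hs : (T : H →ₗ[ℂ] H).IsSymmetric) (l : ℂ)
    (hG : ∀ w f, (w, f) ∈ A.graph ↔ w = T (f + l • w)) : HasDiscreteSpectrum A := by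
  -- The resolvent is `(A - z)⁻¹ = (1 - (z + l) T)⁻¹ T`.
  have hunit : ∀ z, IsUnit (1 - (z + l) • T) → z ∈ opResolventSet A := by
    intro z hz
    obtain ⟨U, hU⟩ := hz
    have hU1 : ∀ x, U.1 (U.2 x) = x := fun x => by
      rw [← mul_apply_eq_comp, U.3]; rfl
    have hU2 : ∀ x, U.2 (U.1 x) = x := fun x => by
      rw [← mul_apply_eq_comp, U.4]; rfl
    have hUa : ∀ x, U.1 x = x - (z + l) • T x := fun x => by rw [hU]; rfl
    refine ⟨U.2 * T, fun f => ?_, fun u => ?_⟩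
    · have h1 : (U.2 (T f), f + z • U.2 (T f)) ∈ A.graph := by
        rw [hG]
        have := hU1 (T f)
        rw [hUa] at this
        rw [add_assoc, ← add_smul, map_add, map_smul]
        nth_rewrite 2 [← this]
        abel
      obtain ⟨y, hy, hy'⟩ := A.mem_graph_iff.1 h1
      simp only at hy hy'
      refine ⟨by change U.2 (T f) ∈ _; rw [← hy]; exact y.2, ?_⟩
      have : (⟨(U.2 * T) f, by change U.2 (T f) ∈ _; rw [← hy]; exact y.2⟩ : A.domain) = y :=
        Subtype.ext hy.symm
      rw [this, hy']
      change f + z • U.2 (T f) - z • U.2 (T f) = f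
      abel
    · have h1 := (hG _ _).1 (A.mem_graph u)
      have h2 : U.1 (u : H) = T (A u - z • (u : H)) := by
        rw [hUa]
        nth_rewrite 1 [h1]
        rw [map_sub, map_add, map_smul, map_smul, add_smul]
        abel
      change U.2 (T (A u - z • (u : H))) = u
      rw [← h2, hU2]
  -- Fredholm alternative: a nonzero number outside the resolvent set of the compact `T` is an
  -- eigenvalue.
  have hspec : ∀ z ∈ opSpectrum A, z + l ≠ 0 ∧ HasEigenvalue (T : End ℂ H) (z + l)⁻¹ := by
    intro z hz
    have h0 : z + l ≠ 0 := by
      intro h0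
      exact hz (hunit z (by simp [h0]))
    refine ⟨h0, ?_⟩
    refine (hT.hasEigenvalue_or_mem_resolventSet (inv_ne_zero h0)).resolve_right fun h => ?_
    refine hz (hunit z ?_)
    have h1 := (spectrum.mem_resolventSet_iff.1 h).smul (Units.mk0 _ h0)
    convert h1 using 1
    rw [Units.smul_def, smul_sub, Units.val_mk0, Algebra.algebraMap_eq_smul_one, smul_smul,
      mul_inv_cancel₀ h0, one_smul]
  have heig : ∀ z, z + l ≠ 0 → opEigenspace A z = eigenspace (T : End ℂ H) (z + l)⁻¹ := by
    intro z h0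
    ext w
    rw [mem_opEigenspace, hG, mem_eigenspace_iff, ← add_smul, map_smul, eq_comm]
    exact (eq_inv_smul_iff₀ h0).symm
  intro z hz
  obtain ⟨h0, h1⟩ := hspec z hz
  refine ⟨?_, ?_, ?_⟩
  · obtain ⟨ε, hε, h⟩ := hT.exists_forall_not_hasEigenvalue hs (inv_ne_zero h0)
    have hc : ContinuousAt (fun w : ℂ => (w + l)⁻¹) z := by
      fun_prop (disch := assumption)
    obtain ⟨r, hr, hr'⟩ := Metric.continuousAt_iff.1 hc ε hε
    refine ⟨r, hr, fun w hw hwz => ?_⟩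
    by_contra hne
    refine h _ (by simpa [dist_eq_norm] using hr' (x := w) (by simpa [dist_eq_norm] using hwz)) ?_
      (hspec w hw).2
    intro h'
    exact hne (add_right_cancel (inv_injective h'))
  · rw [heig z h0]; exact h1
  · rw [heig z h0]
    exact ContinuousLinearMap.finite_dimensional_eigenspace hT _ (inv_ne_zero h0)

variable {Q : Type*} [NormedAddCommGroup Q] [InnerProductSpace ℂ Q] [CompleteSpace Q]

/-- The operator defined by a closed semibounded form with compactly embedded form domain has a
compact resolvent. -/
lemma exists_compact_resolvent {J : Q →L[ℂ] H} (hJ : IsCompactOperator J)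
    (b : Q →L⋆[ℂ] Q →L[ℂ] ℂ) (hb : ∀ u v, b v u = starRingEnd ℂ (b u v)) (l : ℝ) {c : ℝ}
    (hc : 0 < c) (hcoer : ∀ u, c * ‖u‖ ^ 2 ≤ (b u u).re + l * ‖J u‖ ^ 2) :
    ∃ T : H →L[ℂ] H, IsCompactOperator T ∧ (T : H →ₗ[ℂ] H).IsSymmetric ∧
      ∀ w f, (∃ u, w = J u ∧ ∀ v, b v u = ⟪J v, f⟫_ℂ) ↔ w = T (f + (l : ℂ) • w) := by
  let B : Q →L[ℂ] Q := InnerProductSpace.continuousLinearMapOfBilin b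
  have hB : ∀ v u, ⟪B v, u⟫_ℂ = b v u := fun v u =>
    InnerProductSpace.continuousLinearMapOfBilin_apply b v u
  have hB' : ∀ v u, ⟪v, B u⟫_ℂ = b v u := fun v u => by
    rw [← inner_conj_symm, hB, ← hb]
  let J' : H →L[ℂ] Q := ContinuousLinearMap.adjoint J
  have hJ' : ∀ v f, ⟪v, J' f⟫_ℂ = ⟪J v, f⟫_ℂ := fun v f => J.adjoint_inner_right v f
  -- `S` represents the shifted form `b(v, u) + l ⟨J v, J u⟩`. Coercivity makes it invertible
  -- (Lax–Milgram), and the compact inverse sought is `J S⁻¹ J*`.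
  let S : Q →L[ℂ] Q := B + (l : ℂ) • (J' ∘L J)
  have hSa : ∀ u, S u = B u + (l : ℂ) • J' (J u) := fun u => rfl
  have hSs : ∀ v u, ⟪S v, u⟫_ℂ = ⟪v, S u⟫_ℂ := fun v u => by
    rw [hSa, hSa, inner_add_left, inner_add_right, hB, hB', inner_smul_left, inner_smul_right,
      hJ', Complex.conj_ofReal, ← inner_conj_symm (J' (J v)), hJ', inner_conj_symm]
  have hSu : IsUnit S := by
    refine ContinuousLinearMap.isUnit_of_forall_le_norm_inner_map S (c := ⟨c, hc.le⟩) hc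
      fun x => ?_
    have h1 : (⟪S x, x⟫_ℂ).re = (b x x).re + l * ‖J x‖ ^ 2 := by
      rw [hSs, hSa, inner_add_right, inner_smul_right, hJ', hB', inner_self_eq_norm_sq_to_K]
      simp [← Complex.ofReal_pow]
    calc ‖x‖ ^ 2 * c = c * ‖x‖ ^ 2 := mul_comm _ _
      _ ≤ (⟪S x, x⟫_ℂ).re := by rw [h1]; exact hcoer x
      _ ≤ ‖⟪S x, x⟫_ℂ‖ := Complex.re_le_norm _
  obtain ⟨U, hU⟩ := hSu
  have hU1 : ∀ x, S (U.2 x) = x := fun x => by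
    rw [← hU, ← mul_apply_eq_comp, U.3]; rfl
  have hU2 : ∀ x, U.2 (S x) = x := fun x => by
    rw [← hU, ← mul_apply_eq_comp, U.4]; rfl
  refine ⟨J ∘L U.2 ∘L J', hJ.comp_clm (U.2 ∘L J'), fun x y => ?_, fun w f => ?_⟩
  · change ⟪J (U.2 (J' x)), y⟫_ℂ = ⟪x, J (U.2 (J' y))⟫_ℂ
    rw [← hJ', ← inner_conj_symm x, ← hJ', inner_conj_symm]
    have := hSs (U.2 (J' x)) (U.2 (J' y))
    rw [hU1, hU1] at this
    exact this.symm
  -- The weak equation `b(·, u) = ⟨J ·, f⟩` is `B u = J* f`; adding `l J* J u` to both sides turns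
  -- it into an equation for the invertible `S`.
  · have key : ∀ u, (∀ v, b v u = ⟪J v, f⟫_ℂ) ↔ S u = J' (f + (l : ℂ) • J u) := by
      intro u
      rw [hSa, map_add, map_smul, add_left_inj]
      constructor
      · intro h
        refine ext_inner_left ℂ fun v => ?_
        rw [hB', hJ', h]
      · intro h v
        rw [← hB', h, hJ']
    constructor
    · rintro ⟨u, rfl, hu⟩
      change J u = J (U.2 (J' _))
      rw [← (key u).1 hu, hU2]
    · intro h
      refine ⟨U.2 (J' (f + (l : ℂ) • w)), h, (key _).2 ?_⟩
      rw [hU1]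
      congr 3

end Abstract

/-! ### Positive semidefinite matrices -/

section Matrices

variable {M : ℕ} {A : Matrix (Fin M) (Fin M) ℂ}

lemma Matrix.PosSemidef.inner_matApply (hA : A.PosSemidef) (v u : CVec M) :
    ⟪v, matApply A u⟫_ℂ = ∑ l, (hA.1.eigenvalues l : ℂ) *
      (⟪v, hA.1.eigenvectorBasis l⟫_ℂ * ⟪hA.1.eigenvectorBasis l, u⟫_ℂ) := by
  have hs : (Matrix.toEuclideanLin A).IsSymmetric := Matrix.isSymmetric_toEuclideanLin_iff.2 hA.1
  rw [← hA.1.eigenvectorBasis.sum_inner_mul_inner]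
  refine Finset.sum_congr rfl fun l _ => ?_
  have h1 : Matrix.toEuclideanLin A (hA.1.eigenvectorBasis l) =
      (hA.1.eigenvalues l : ℂ) • hA.1.eigenvectorBasis l := by
    have := hA.1.mulVec_eigenvectorBasis l
    ext i
    simpa [Matrix.toEuclideanLin] using congrFun this i
  rw [← hs, h1, inner_smul_left, Complex.conj_ofReal]
  ring

lemma Matrix.PosSemidef.traceRpow_eq (hA : A.PosSemidef) :
    traceRpow A = ∑ l, hA.1.eigenvalues l ^ (3 / 2 : ℝ) := by
  rw [traceRpow, hA.1.cfc_eq, Matrix.IsHermitian.cfc, Unitary.conjStarAlgAut_apply,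
    Matrix.trace_mul_cycle, Unitary.coe_star_mul_self, one_mul, Matrix.trace_diagonal]
  simp

lemma Matrix.PosSemidef.traceRpow_nonneg (hA : A.PosSemidef) : 0 ≤ traceRpow A := by
  rw [hA.traceRpow_eq]
  exact Finset.sum_nonneg fun l _ => Real.rpow_nonneg (hA.eigenvalues_nonneg l) _

/-- Since `λ ≤ 1 + λ^{3/2}` for every eigenvalue, integrability of `Tr V^{3/2}` on a bounded
interval forces integrability of the norm of `V`. This is the only size information on `V` needed to
define the form. -/
lemma Matrix.PosSemidef.norm_inner_matApply_le (hA : A.PosSemidef) (v u : CVec M) :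
    ‖⟪v, matApply A u⟫_ℂ‖ ≤ (M + traceRpow A) * (‖v‖ * ‖u‖) := by
  have h1 : ∀ l, hA.1.eigenvalues l ≤ 1 + hA.1.eigenvalues l ^ (3 / 2 : ℝ) := fun l => by
    have h0 := hA.eigenvalues_nonneg l
    rcases le_total (hA.1.eigenvalues l) 1 with h | h
    · linarith [Real.rpow_nonneg h0 (3 / 2 : ℝ)]
    · have := Real.rpow_le_rpow_of_exponent_le h (show (1 : ℝ) ≤ 3 / 2 by norm_num)
      rw [Real.rpow_one] at this
      linarith
  have h2 : (M : ℝ) + traceRpow A = ∑ l, (1 + hA.1.eigenvalues l ^ (3 / 2 : ℝ)) := by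
    rw [Finset.sum_add_distrib, hA.traceRpow_eq]; simp
  rw [hA.inner_matApply, h2, Finset.sum_mul]
  refine (norm_sum_le _ _).trans (Finset.sum_le_sum fun l _ => ?_)
  rw [norm_mul, norm_mul, Complex.norm_real, Real.norm_of_nonneg (hA.eigenvalues_nonneg l)]
  have hl : ‖hA.1.eigenvectorBasis l‖ = 1 := hA.1.eigenvectorBasis.orthonormal.1 l
  have h3 := norm_inner_le_norm (𝕜 := ℂ) v (hA.1.eigenvectorBasis l)
  have h4 := norm_inner_le_norm (𝕜 := ℂ) (hA.1.eigenvectorBasis l) u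
  rw [hl, mul_one] at h3
  rw [hl, one_mul] at h4
  exact mul_le_mul (h1 l) (mul_le_mul h3 h4 (norm_nonneg _) (norm_nonneg _)) (by positivity)
    (by linarith [Real.rpow_nonneg (hA.eigenvalues_nonneg l) (3 / 2 : ℝ)])

lemma Matrix.PosSemidef.re_inner_matApply_self (hA : A.PosSemidef) (v : CVec M) :
    (⟪v, matApply A v⟫_ℂ).re = ∑ l, ‖⟪hA.1.eigenvectorBasis l, v⟫_ℂ‖ ^ 2 * hA.1.eigenvalues l := by
  rw [hA.inner_matApply, Complex.re_sum]
  refine Finset.sum_congr rfl fun l _ => ?_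
  rw [← inner_conj_symm v, ← Complex.normSq_eq_conj_mul_self, ← Complex.ofReal_mul,
    Complex.ofReal_re, Complex.normSq_eq_norm_sq, mul_comm]

lemma Matrix.PosSemidef.re_inner_matApply_nonneg (hA : A.PosSemidef) (v : CVec M) :
    0 ≤ (⟪v, matApply A v⟫_ℂ).re := by
  rw [hA.re_inner_matApply_self]
  exact Finset.sum_nonneg fun l _ => mul_nonneg (by positivity) (hA.eigenvalues_nonneg l)

/-- Peierls' inequality for the power `3/2`. -/
lemma Matrix.PosSemidef.sum_rpow_le_traceRpow (hA : A.PosSemidef) {κ : Type*} [Fintype κ]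
    (b : OrthonormalBasis κ ℂ (CVec M)) :
    ∑ k, (⟪b k, matApply A (b k)⟫_ℂ).re ^ (3 / 2 : ℝ) ≤ traceRpow A := by
  have h1 : ∀ k, (⟪b k, matApply A (b k)⟫_ℂ).re ^ (3 / 2 : ℝ) ≤
      ∑ l, ‖⟪hA.1.eigenvectorBasis l, b k⟫_ℂ‖ ^ 2 * hA.1.eigenvalues l ^ (3 / 2 : ℝ) := by
    intro k
    rw [hA.re_inner_matApply_self]
    -- Jensen: for fixed `k` the weights `‖⟨e_l, b_k⟩‖²` sum to one over the eigenbasis `e_l`.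
    -- Below, for fixed `l`, they also sum to one over `k`.
    refine (convexOn_rpow (show (1 : ℝ) ≤ 3 / 2 by norm_num)).map_sum_le (fun l _ => by positivity)
      ?_ fun l _ => hA.eigenvalues_nonneg l
    rw [hA.1.eigenvectorBasis.sum_sq_norm_inner_right, b.orthonormal.1 k, one_pow]
  refine (Finset.sum_le_sum fun k _ => h1 k).trans ?_
  rw [Finset.sum_comm, hA.traceRpow_eq]
  refine (Finset.sum_congr rfl fun l _ => ?_).le
  rw [← Finset.sum_mul, b.sum_sq_norm_inner_left, hA.1.eigenvectorBasis.orthonormal.1 l, one_pow,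
    one_mul]

end Matrices

/-! ### One-dimensional Sobolev inequalities -/

/-- Cauchy–Schwarz against the constant `1`, obtained from `∫ (f - m)² ≥ 0` with `m` the mean of
`f`. -/
lemma sq_setIntegral_le {f : ℝ → ℝ} {a b : ℝ} (hab : a ≤ b)
    (hf : MemLp f 2 (volume.restrict (Ioc a b))) :
    (∫ t in Ioc a b, f t) ^ 2 ≤ (b - a) * ∫ t in Ioc a b, f t ^ 2 := by
  rcases hab.eq_or_lt with rfl | hab
  · simp
  have h1 : Integrable f (volume.restrict (Ioc a b)) := hf.integrable one_le_two
  have h2 : Integrable (fun t => f t ^ 2) (volume.restrict (Ioc a b)) := hf.integrable_sq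
  set m : ℝ := (∫ t in Ioc a b, f t) / (b - a) with hm
  have h0 : 0 ≤ ∫ t in Ioc a b, (f t - m) ^ 2 := integral_nonneg fun t => sq_nonneg _
  have h3 : ∫ t in Ioc a b, (f t - m) ^ 2 =
      (∫ t in Ioc a b, f t ^ 2) - 2 * m * (∫ t in Ioc a b, f t) + m ^ 2 * (b - a) := by
    have : ∀ t, (f t - m) ^ 2 = f t ^ 2 - 2 * m * f t + m ^ 2 := fun t => by ring
    simp only [this]
    have h5 : Integrable (fun t => f t ^ 2 - 2 * m * f t) (volume.restrict (Ioc a b)) :=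
      h2.sub (h1.const_mul _)
    rw [integral_add h5 (integrable_const _), integral_sub h2 (h1.const_mul _), integral_const_mul]
    simp [hab.le, mul_comm]
  have h4 : (∫ t in Ioc a b, f t) = m * (b - a) := by
    rw [hm, div_mul_cancel₀ _ (sub_pos.2 hab).ne']
  rw [h3, h4] at h0
  rw [h4]
  have h5 := mul_nonneg (sub_pos.2 hab).le h0
  nlinarith

namespace IsPerH1

section

variable {E F : Type*} [NormedAddCommGroup E] [NormedSpace ℝ E] [NormedAddCommGroup F]
  [NormedSpace ℝ F] {L : ℝ} {u g : ℝ → E}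

lemma clm [CompleteSpace E] [CompleteSpace F] (hu : IsPerH1 L u g) (T : E →L[ℝ] F) :
    IsPerH1 L (fun x => T (u x)) fun x => T (g x) := by
  refine ⟨T.comp_memLp' hu.deriv_memLp, fun x hx => ?_, by rw [hu.periodic]⟩
  rw [hu.eq_primitive x hx, map_add, T.intervalIntegral_comp_comm (hu.intervalIntegrable hx)]

lemma sq_dist_le (hu : IsPerH1 L u g) {x y : ℝ} (hx : x ∈ Icc 0 L) (hy : y ∈ Icc 0 L)
    (hxy : x ≤ y) : ‖u y - u x‖ ^ 2 ≤ (y - x) * ∫ t, ‖g t‖ ^ 2 ∂perMeasure L := by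
  have hsub : Ioc x y ⊆ Ioc 0 L := Ioc_subset_Ioc hx.1 hy.2
  have hle : (volume : Measure ℝ).restrict (Ioc x y) ≤ perMeasure L :=
    Measure.restrict_mono hsub le_rfl
  have h1 : u y - u x = ∫ t in Ioc x y, g t := by
    rw [hu.eq_primitive y hy, hu.eq_primitive x hx, add_sub_add_left_eq_sub,
      intervalIntegral.integral_interval_sub_left (hu.intervalIntegrable hy)
        (hu.intervalIntegrable hx), intervalIntegral.integral_of_le hxy]
  have h2 : ‖u y - u x‖ ≤ ∫ t in Ioc x y, ‖g t‖ := by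
    rw [h1]; exact norm_integral_le_integral_norm _
  calc ‖u y - u x‖ ^ 2 ≤ (∫ t in Ioc x y, ‖g t‖) ^ 2 := by gcongr
    _ ≤ (y - x) * ∫ t in Ioc x y, ‖g t‖ ^ 2 :=
        sq_setIntegral_le hxy (hu.deriv_memLp.norm.mono_measure hle)
    _ ≤ _ := mul_le_mul_of_nonneg_left
        (integral_mono_measure hle (Filter.Eventually.of_forall fun t => by positivity)
          hu.deriv_memLp.norm.integrable_sq) (sub_nonneg.2 hxy)

/-- Average `‖u x‖² ≤ 2‖u y‖² + 2‖u x - u y‖²` over `y` in a window of length `l` that contains `x`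
and lies inside `[0, L]`. The free length `l` matters: a small `l` makes the derivative term small
(coercivity), an optimised `l` gives a multiplicative inequality. -/
lemma sq_norm_le (hu : IsPerH1 L u g) {x l : ℝ} (hx : x ∈ Icc 0 L) (hl : 0 < l) (hlL : l ≤ L) :
    ‖u x‖ ^ 2 ≤ 2 / l * (∫ t, ‖u t‖ ^ 2 ∂perMeasure L) +
      2 * l * ∫ t, ‖g t‖ ^ 2 ∂perMeasure L := by
  set G := ∫ t, ‖g t‖ ^ 2 ∂perMeasure L
  have hG : 0 ≤ G := integral_nonneg fun t => by positivity
  obtain ⟨a, ha0, hax, hxa, haL⟩ : ∃ a, 0 ≤ a ∧ a ≤ x ∧ x ≤ a + l ∧ a + l ≤ L := by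
    refine ⟨min x (L - l), le_min hx.1 (by linarith), min_le_left _ _, ?_, ?_⟩
    · rcases min_cases x (L - l) with h | h <;> linarith [hx.2]
    · linarith [min_le_right x (L - l)]
  have hsub : Ioc a (a + l) ⊆ Ioc 0 L := Ioc_subset_Ioc ha0 haL
  have hle : (volume : Measure ℝ).restrict (Ioc a (a + l)) ≤ perMeasure L :=
    Measure.restrict_mono hsub le_rfl
  have hsq : Integrable (fun t => ‖u t‖ ^ 2) (perMeasure L) := hu.memLp.norm.integrable_sq
  have h1 : ∀ y ∈ Ioc a (a + l), ‖u x‖ ^ 2 ≤ 2 * ‖u y‖ ^ 2 + 2 * (l * G) := by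
    intro y hy
    have hyL : y ∈ Icc 0 L := Ioc_subset_Icc_self (hsub hy)
    have h2 : ‖u x - u y‖ ^ 2 ≤ l * G := by
      rcases le_total x y with h | h
      · rw [norm_sub_rev]
        exact (hu.sq_dist_le hx hyL h).trans
          (mul_le_mul_of_nonneg_right (by linarith [hy.2]) hG)
      · exact (hu.sq_dist_le hyL hx h).trans
          (mul_le_mul_of_nonneg_right (by linarith [hy.1]) hG)
    have h3 : ‖u x‖ ≤ ‖u y‖ + ‖u x - u y‖ := by
      have := norm_add_le (u y) (u x - u y)
      rwa [add_sub_cancel] at this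
    have h4 : ‖u x‖ ^ 2 ≤ (‖u y‖ + ‖u x - u y‖) ^ 2 := by gcongr
    nlinarith [sq_nonneg (‖u y‖ - ‖u x - u y‖)]
  have h2 : ∫ _y in Ioc a (a + l), ‖u x‖ ^ 2 ≤
      ∫ y in Ioc a (a + l), (2 * ‖u y‖ ^ 2 + 2 * (l * G)) := by
    refine setIntegral_mono_on (integrable_const _) ?_ measurableSet_Ioc h1
    exact ((hsq.mono_measure hle).const_mul 2).add (integrable_const _)
  rw [integral_add ((hsq.mono_measure hle).const_mul 2) (integrable_const _),
    integral_const_mul] at h2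
  have h3 : ∫ y in Ioc a (a + l), ‖u y‖ ^ 2 ≤ ∫ t, ‖u t‖ ^ 2 ∂perMeasure L :=
    integral_mono_measure hle (Filter.Eventually.of_forall fun t => by positivity) hsq
  simp only [integral_const, MeasurableSet.univ, measureReal_restrict_apply, univ_inter,
    Real.volume_real_Ioc, add_sub_cancel_left, max_eq_left hl.le, smul_eq_mul] at h2
  have h4 : l * ‖u x‖ ^ 2 ≤ l * (2 / l * (∫ t, ‖u t‖ ^ 2 ∂perMeasure L) + 2 * l * G) := by
    have : l * (2 / l * (∫ t, ‖u t‖ ^ 2 ∂perMeasure L) + 2 * l * G) =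
        2 * (∫ t, ‖u t‖ ^ 2 ∂perMeasure L) + l * (2 * (l * G)) := by
      field_simp
    rw [this]
    linarith
  exact le_of_mul_le_mul_left h4 hl

/-- Optimisation over the window length: `l = a / b` balances the two terms, where `a` and `b` are
the `L₂` norms of `u` and `g`; if `a / b` exceeds `L`, take `l = L`. The constants are not sharp;
the inequality only shows that admissible constants exist. -/
lemma sq_norm_le_mul (hL : 0 < L) (hu : IsPerH1 L u g) {x : ℝ} (hx : x ∈ Icc 0 L) :
    ‖u x‖ ^ 2 ≤ 2 / L * (∫ t, ‖u t‖ ^ 2 ∂perMeasure L) +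
      4 * (Real.sqrt (∫ t, ‖u t‖ ^ 2 ∂perMeasure L) *
        Real.sqrt (∫ t, ‖g t‖ ^ 2 ∂perMeasure L)) := by
  have hA : 0 ≤ ∫ t, ‖u t‖ ^ 2 ∂perMeasure L := integral_nonneg fun t => by positivity
  have hB : 0 ≤ ∫ t, ‖g t‖ ^ 2 ∂perMeasure L := integral_nonneg fun t => by positivity
  have key := fun l h1 h2 => hu.sq_norm_le (l := l) hx h1 h2
  set a := Real.sqrt (∫ t, ‖u t‖ ^ 2 ∂perMeasure L)
  set b := Real.sqrt (∫ t, ‖g t‖ ^ 2 ∂perMeasure L)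
  have ha : 0 ≤ a := Real.sqrt_nonneg _
  have hb : 0 ≤ b := Real.sqrt_nonneg _
  rw [← Real.sq_sqrt hA]
  rw [← Real.sq_sqrt hA, ← Real.sq_sqrt hB] at key
  change ∀ l, 0 < l → l ≤ L → ‖u x‖ ^ 2 ≤ 2 / l * a ^ 2 + 2 * l * b ^ 2 at key
  change ‖u x‖ ^ 2 ≤ 2 / L * a ^ 2 + 4 * (a * b)
  rcases le_or_gt (b * L) a with h | h
  · have := key L hL le_rfl
    nlinarith [mul_nonneg ha hb, mul_le_mul_of_nonneg_right h hb]
  · have hb0 : 0 < b := by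
      rcases hb.eq_or_lt with h0 | h0
      · rw [← h0, zero_mul] at h; linarith
      · exact h0
    rcases ha.eq_or_lt with h0 | h0
    · rw [← h0] at key ⊢
      -- For `a = 0` the optimal window shrinks to a point, so `l` tends to `0` instead.
      have h1 : ∀ ε, 0 < ε → ‖u x‖ ^ 2 ≤ 0 + ε := by
        intro ε hε
        have hl : 0 < min L (ε / (2 * b ^ 2)) := lt_min hL (by positivity)
        have h2 := key _ hl (min_le_left _ _)
        have h3 : 2 * min L (ε / (2 * b ^ 2)) * b ^ 2 ≤ ε := by
          calc 2 * min L (ε / (2 * b ^ 2)) * b ^ 2 ≤ 2 * (ε / (2 * b ^ 2)) * b ^ 2 := by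
                gcongr; exact min_le_right _ _
            _ = ε := by field_simp
        simp only [ne_eq, OfNat.ofNat_ne_zero, not_false_eq_true, zero_pow, mul_zero] at h2
        linarith
      simpa using le_of_forall_pos_le_add h1
    · have h1 := key (a / b) (by positivity) (by rw [div_le_iff₀ hb0]; linarith)
      have h2 : 2 / (a / b) * a ^ 2 + 2 * (a / b) * b ^ 2 = 4 * (a * b) := by
        field_simp; ring
      rw [h2] at h1
      have : 0 ≤ 2 / L * a ^ 2 := by positivity
      linarith

end

/-! ### Integration by parts and Wirtinger's inequality -/

/-- Integration by parts against a continuously differentiable function. -/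
lemma integral_deriv_mul {L : ℝ} (hL : 0 ≤ L) {u g : ℝ → ℂ} (hu : IsPerH1 L u g) {φ φ' : ℝ → ℂ}
    (hφ : ∀ x, HasDerivAt φ (φ' x) x) (hφ' : Continuous φ') :
    ∫ x, φ' x * u x ∂perMeasure L =
      φ L * u L - φ 0 * u 0 - ∫ x, φ x * g x ∂perMeasure L := by
  have hφc : Continuous φ := continuous_iff_continuousAt.2 fun x => (hφ x).continuousAt
  have hft : ∀ a b, ∫ x in a..b, φ' x = φ b - φ a := fun a b =>
    intervalIntegral.integral_eq_sub_of_hasDerivAt (fun x _ => hφ x)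
      (hφ'.intervalIntegrable _ _)
  have hi' : Integrable φ' (perMeasure L) :=
    (hφ'.integrableOn_Icc (a := 0) (b := L)).mono_set Ioc_subset_Icc_self
  have hg := hu.integrable_deriv
  -- Fubini on the triangle `t ≤ x` for `φ'(x) g(t)`: integrating first in `t` produces `φ'(x) (u x
  -- - u 0)`, first in `x` produces `(φ L - φ t) g t`.
  have hprod : Integrable (Function.uncurry fun x t => if t ≤ x then φ' x * g t else 0)
      ((perMeasure L).prod (perMeasure L)) := by
    have h1 := (hi'.mul_prod hg).indicator
      (measurableSet_le measurable_snd measurable_fst : MeasurableSet {p : ℝ × ℝ | p.2 ≤ p.1})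
    refine h1.congr (Filter.Eventually.of_forall fun p => ?_)
    simp [Function.uncurry, indicator]
  have hswap := integral_integral_swap hprod
  have hl : ∀ x ∈ Ioc 0 L, ∫ t, (if t ≤ x then φ' x * g t else 0) ∂perMeasure L =
      φ' x * (u x - u 0) := by
    intro x hx
    have h1 : u x - u 0 = ∫ t in Ioc 0 x, g t := by
      rw [hu.eq_primitive x (Ioc_subset_Icc_self hx), add_sub_cancel_left,
        intervalIntegral.integral_of_le hx.1.le]
    have h2 : (fun t => if t ≤ x then φ' x * g t else 0) =
        (Iic x).indicator fun t => φ' x * g t := by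
      ext t; simp [indicator]
    rw [h2, setIntegral_indicator measurableSet_Iic, Ioc_inter_Iic, min_eq_right hx.2,
      integral_const_mul, ← h1]
  have hr : ∀ t ∈ Ioc 0 L, ∫ x, (if t ≤ x then φ' x * g t else 0) ∂perMeasure L =
      (φ L - φ t) * g t := by
    intro t ht
    have h2 : (fun x => if t ≤ x then φ' x * g t else 0) =
        (Ici t).indicator fun x => φ' x * g t := by
      ext x; simp [indicator]
    have h3 : Ioc 0 L ∩ Ici t = Icc t L := by
      ext x
      simp only [mem_inter_iff, mem_Ioc, mem_Ici, mem_Icc]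
      exact ⟨fun h => ⟨h.2, h.1.2⟩, fun h => ⟨⟨ht.1.trans_le h.1, h.2⟩, h.1⟩⟩
    rw [h2, setIntegral_indicator measurableSet_Ici, h3, integral_Icc_eq_integral_Ioc,
      integral_mul_const, ← intervalIntegral.integral_of_le ht.2, hft]
  rw [setIntegral_congr_fun measurableSet_Ioc hl, setIntegral_congr_fun measurableSet_Ioc hr]
    at hswap
  have hub : Integrable (fun x => φ' x * u x) (perMeasure L) := by
    obtain ⟨C, hC⟩ := isCompact_Icc.exists_bound_of_continuousOn (hφ'.continuousOn (s := Icc 0 L))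
    refine hu.integrable.bdd_mul hφ'.aestronglyMeasurable (c := C) ?_
    filter_upwards [ae_restrict_mem measurableSet_Ioc] with x hx
    exact hC x (Ioc_subset_Icc_self hx)
  have hgb : Integrable (fun x => φ x * g x) (perMeasure L) := by
    obtain ⟨C, hC⟩ := isCompact_Icc.exists_bound_of_continuousOn (hφc.continuousOn (s := Icc 0 L))
    refine hg.bdd_mul hφc.aestronglyMeasurable (c := C) ?_
    filter_upwards [ae_restrict_mem measurableSet_Ioc] with x hx
    exact hC x (Ioc_subset_Icc_self hx)
  have hgL : ∫ t, g t ∂perMeasure L = u L - u 0 := by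
    rw [hu.eq_primitive L ⟨hL, le_rfl⟩, add_sub_cancel_left, intervalIntegral.integral_of_le hL]
  have hφL : ∫ t, φ' t ∂perMeasure L = φ L - φ 0 := by
    rw [← hft, intervalIntegral.integral_of_le hL]
  simp only [mul_sub, sub_mul] at hswap
  rw [integral_sub hub (hi'.mul_const _), integral_sub (hg.const_mul _) hgb, integral_mul_const,
    integral_const_mul, hgL, hφL] at hswap
  linear_combination hswap

/-- Parseval: the `n`-th Fourier coefficient of `u'` is `i n` times that of `u`, and the zeroth
coefficient of `u` vanishes. -/
lemma wirtinger_complex {u g : ℝ → ℂ} (hu : IsPerH1 (2 * Real.pi) u g)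
    (h0 : ∫ t, u t ∂perMeasure (2 * Real.pi) = 0) :
    ∫ t, ‖u t‖ ^ 2 ∂perMeasure (2 * Real.pi) ≤ ∫ t, ‖g t‖ ^ 2 ∂perMeasure (2 * Real.pi) := by
  have hL : (0 : ℝ) < 2 * Real.pi := by positivity
  have hsu := hasSum_sq_fourierCoeffOn hL hu.memLp
  have hsg := hasSum_sq_fourierCoeffOn hL hu.deriv_memLp
  rw [intervalIntegral.integral_of_le hL.le] at hsu hsg
  have key : ∀ n : ℤ, ‖fourierCoeffOn hL u n‖ ^ 2 ≤ ‖fourierCoeffOn hL g n‖ ^ 2 := by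
    intro n
    rcases eq_or_ne n 0 with rfl | hn
    · have : fourierCoeffOn hL u 0 = 0 := by
        rw [fourierCoeffOn_eq_integral, intervalIntegral.integral_of_le hL.le]
        simp [h0]
      rw [this]; simp
    · have h1 := hu.integral_deriv_mul hL.le
        (φ := fun x : ℝ => fourier (-n) (x : AddCircle (2 * Real.pi - 0)))
        (φ' := fun x : ℝ => -2 * Real.pi * Complex.I * n / ((2 * Real.pi - 0 : ℝ) : ℂ) *
          fourier (-n) (x : AddCircle (2 * Real.pi - 0)))
        (fun x => hasDerivAt_fourier_neg _ n x)
        (continuous_const.mul ((map_continuous _).comp (AddCircle.continuous_mk' _)))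
      -- The exponential takes equal values at both ends, as does `u`, so the boundary terms cancel.
      have h2 : (fourier (-n) ((2 * Real.pi : ℝ) : AddCircle (2 * Real.pi - 0)) : ℂ) =
          fourier (-n) ((0 : ℝ) : AddCircle (2 * Real.pi - 0)) := by
        congr 1
        have := AddCircle.coe_period (2 * Real.pi - 0)
        rw [AddCircle.coe_zero]
        convert this using 2
        ring
      rw [h2, hu.periodic, sub_self, zero_sub] at h1
      simp only [mul_assoc] at h1
      rw [integral_const_mul] at h1
      have h3 : fourierCoeffOn hL g n = Complex.I * n * fourierCoeffOn hL u n := by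
        rw [fourierCoeffOn_eq_integral, fourierCoeffOn_eq_integral,
          intervalIntegral.integral_of_le hL.le, intervalIntegral.integral_of_le hL.le]
        simp only [smul_eq_mul, Complex.real_smul]
        rw [← neg_eq_iff_eq_neg.2 h1]
        have hpi : (Real.pi : ℂ) ≠ 0 := by exact_mod_cast Real.pi_ne_zero
        push_cast
        field_simp
        simp
      rw [h3, norm_mul, norm_mul, Complex.norm_I, one_mul, mul_pow]
      have h4 : (1 : ℝ) ≤ ‖(n : ℂ)‖ ^ 2 := by
        rw [Complex.norm_intCast, sq_abs, ← Int.cast_pow]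
        exact_mod_cast Order.one_le_iff_pos.2 (show 0 < n ^ 2 by positivity)
      nlinarith [sq_nonneg ‖fourierCoeffOn hL u n‖]
  have h1 := hasSum_le key hsu hsg
  simp only [smul_eq_mul] at h1
  exact le_of_mul_le_mul_left h1 (by rw [sub_zero]; positivity)

/-- Wirtinger's inequality. -/
lemma wirtinger {M : ℕ} {u g : ℝ → CVec M} (hu : IsPerH1 (2 * Real.pi) u g)
    (h0 : ∫ t, u t ∂perMeasure (2 * Real.pi) = 0) :
    ∫ t, ‖u t‖ ^ 2 ∂perMeasure (2 * Real.pi) ≤ ∫ t, ‖g t‖ ^ 2 ∂perMeasure (2 * Real.pi) := by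
  have hL : (0 : ℝ) ≤ 2 * Real.pi := by positivity
  let T : Fin M → CVec M →L[ℝ] ℂ := fun i =>
    (EuclideanSpace.proj i : CVec M →L[ℂ] ℂ).restrictScalars ℝ
  have hT : ∀ i, IsPerH1 (2 * Real.pi) (fun x => u x i) fun x => g x i := fun i => hu.clm (T i)
  simp only [EuclideanSpace.norm_sq_eq]
  rw [integral_finsetSum _ fun i _ => (hT i).memLp.norm.integrable_sq,
    integral_finsetSum _ fun i _ => (hT i).deriv_memLp.norm.integrable_sq]
  refine Finset.sum_le_sum fun i _ => (hT i).wirtinger_complex ?_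
  have := (T i).integral_comp_comm hu.integrable
  rw [h0, map_zero] at this
  exact this

lemma wirtinger_real {u g : ℝ → ℝ} (hu : IsPerH1 (2 * Real.pi) u g)
    (h0 : ∫ t, u t ∂perMeasure (2 * Real.pi) = 0) :
    ∫ t, u t ^ 2 ∂perMeasure (2 * Real.pi) ≤ ∫ t, g t ^ 2 ∂perMeasure (2 * Real.pi) := by
  have hL : (0 : ℝ) ≤ 2 * Real.pi := by positivity
  have h1 := (hu.clm Complex.ofRealCLM).wirtinger_complex (by
    have := Complex.ofRealCLM.integral_comp_comm hu.integrable
    rw [h0, map_zero] at this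
    exact this)
  simpa using h1

end IsPerH1

/-! ### The sharp constants -/

/-- `K` is admissible in `‖u‖_∞² ≤ K (∫ (u'² + c u²))^{1/2} (∫ u²)^{1/2}` for real periodic `u`,
of mean zero if `mz` holds. -/
def IsInterpConst (L c : ℝ) (mz : Prop) (K : ℝ) : Prop :=
  ∀ u u' : ℝ → ℝ, IsPerH1 L u u' → (mz → ∫ t, u t ∂perMeasure L = 0) → ∀ x ∈ Icc 0 L,
    u x ^ 2 ≤ K * Real.sqrt (∫ t, (u' t ^ 2 + c * u t ^ 2) ∂perMeasure L) *
      Real.sqrt (∫ t, u t ^ 2 ∂perMeasure L)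

/-- Each instance is a non-strict inequality, continuous in `K`. Closedness is what puts the infimum
itself among the admissible constants. -/
lemma isClosed_isInterpConst (L c : ℝ) (mz : Prop) : IsClosed {K | IsInterpConst L c mz K} := by
  simp only [IsInterpConst, ofPred_forall]
  refine isClosed_iInter fun u => isClosed_iInter fun u' => isClosed_iInter fun _ =>
    isClosed_iInter fun _ => isClosed_iInter fun x => isClosed_iInter fun _ => ?_
  exact isClosed_le continuous_const (by fun_prop)

lemma integral_deriv_sq_add {L : ℝ} {u g : ℝ → ℝ} (hu : IsPerH1 L u g) (c : ℝ) :
    ∫ t, (g t ^ 2 + c * u t ^ 2) ∂perMeasure L =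
      (∫ t, g t ^ 2 ∂perMeasure L) + c * ∫ t, u t ^ 2 ∂perMeasure L := by
  rw [integral_add hu.deriv_memLp.integrable_sq (hu.memLp.integrable_sq.const_mul c),
    integral_const_mul]

lemma sharpK1_spec {β : ℝ} (hβ : 0 < β) : 0 ≤ sharpK1 β ∧
    ∀ α : ℝ, 0 < α → IsInterpConst (2 * Real.pi / α) (α ^ 2 * β) False (sharpK1 β) := by
  have hset : {K : ℝ | 0 ≤ K ∧ ∀ α : ℝ, 0 < α → ∀ u u' : ℝ → ℝ, IsPerH1 (2 * Real.pi / α) u u' →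
      ∀ x ∈ Icc 0 (2 * Real.pi / α), u x ^ 2 ≤
      K * Real.sqrt (∫ t, (u' t ^ 2 + α ^ 2 * β * u t ^ 2) ∂perMeasure (2 * Real.pi / α)) *
        Real.sqrt (∫ t, u t ^ 2 ∂perMeasure (2 * Real.pi / α))} =
      {K : ℝ | 0 ≤ K} ∩ ⋂ (α : ℝ) (_ : 0 < α),
        {K | IsInterpConst (2 * Real.pi / α) (α ^ 2 * β) False K} := by
    ext K; simp [IsInterpConst]
  have hmem := IsClosed.csInf_mem (s := {K : ℝ | 0 ≤ K} ∩ ⋂ (α : ℝ) (_ : 0 < α),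
        {K | IsInterpConst (2 * Real.pi / α) (α ^ 2 * β) False K})
    (isClosed_Ici.inter (isClosed_iInter fun α => isClosed_iInter fun _ =>
      isClosed_isInterpConst _ _ _)) ?_ ⟨0, fun K hK => hK.1⟩
  · have h2 := hmem.2
    simp only [mem_iInter] at h2
    rw [sharpK1, hset]
    exact ⟨hmem.1, h2⟩
  -- A constant independent of `α`: with `R` the square root of the full energy and `A = ∫ u²`, the
  -- term `(2/L) A = (α/π) A` is at most `1/(π√β) R √A` because `α √β √A ≤ R`, and the product term
  -- contributes `4`.
  · refine ⟨1 / (Real.pi * Real.sqrt β) + 4, by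
      change (0 : ℝ) ≤ _; positivity, mem_iInter.2 fun α => mem_iInter.2 fun hα => ?_⟩
    intro u g hu _ x hx
    have hL : 0 < 2 * Real.pi / α := by positivity
    have h1 := hu.sq_norm_le_mul hL hx
    simp only [Real.norm_eq_abs, sq_abs] at h1
    rw [integral_deriv_sq_add hu]
    have hA : 0 ≤ ∫ t, u t ^ 2 ∂perMeasure (2 * Real.pi / α) := integral_nonneg fun t => by positivity
    have hB : 0 ≤ ∫ t, g t ^ 2 ∂perMeasure (2 * Real.pi / α) := integral_nonneg fun t => by positivity
    set A := ∫ t, u t ^ 2 ∂perMeasure (2 * Real.pi / α)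
    set B := ∫ t, g t ^ 2 ∂perMeasure (2 * Real.pi / α)
    have h2 : Real.sqrt B ≤ Real.sqrt (B + α ^ 2 * β * A) :=
      Real.sqrt_le_sqrt (by nlinarith [mul_nonneg (mul_nonneg (sq_nonneg α) hβ.le) hA])
    have h3 : α * Real.sqrt β * Real.sqrt A ≤ Real.sqrt (B + α ^ 2 * β * A) := by
      refine Real.le_sqrt_of_sq_le ?_
      rw [mul_pow, mul_pow, Real.sq_sqrt hβ.le, Real.sq_sqrt hA]
      linarith
    set R := Real.sqrt (B + α ^ 2 * β * A)
    have hβ' : 0 < Real.sqrt β := Real.sqrt_pos.2 hβ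
    have h4 : 2 / (2 * Real.pi / α) * A =
        1 / (Real.pi * Real.sqrt β) * (α * Real.sqrt β * Real.sqrt A) * Real.sqrt A := by
      rw [mul_assoc (1 / _), mul_assoc (α * _), Real.mul_self_sqrt hA]
      field_simp
    rw [h4] at h1
    refine h1.trans ?_
    rw [add_mul, add_mul]
    have hsA := Real.sqrt_nonneg A
    refine add_le_add ?_ ?_
    · gcongr
    · rw [mul_assoc, mul_comm (Real.sqrt A)]
      gcongr

lemma sharpK2_spec {δ : ℝ} (hδ0 : 0 ≤ δ) (hδ : δ < 1) : 0 ≤ sharpK2 δ ∧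
    IsInterpConst (2 * Real.pi) (-δ) True (sharpK2 δ) := by
  have hset : {K : ℝ | 0 ≤ K ∧ ∀ u u' : ℝ → ℝ, IsPerH1 (2 * Real.pi) u u' →
      ∫ t, u t ∂perMeasure (2 * Real.pi) = 0 → ∀ x ∈ Icc 0 (2 * Real.pi), u x ^ 2 ≤
      K * Real.sqrt (∫ t, (u' t ^ 2 - δ * u t ^ 2) ∂perMeasure (2 * Real.pi)) *
        Real.sqrt (∫ t, u t ^ 2 ∂perMeasure (2 * Real.pi))} =
      {K : ℝ | 0 ≤ K} ∩ {K | IsInterpConst (2 * Real.pi) (-δ) True K} := by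
    ext K; simp [IsInterpConst, sub_eq_add_neg]
  have hmem := IsClosed.csInf_mem (s := {K : ℝ | 0 ≤ K} ∩
      {K | IsInterpConst (2 * Real.pi) (-δ) True K})
    (isClosed_Ici.inter (isClosed_isInterpConst _ _ _)) ?_ ⟨0, fun K hK => hK.1⟩
  · rw [sharpK2, hset]
    exact hmem
  · have hδ' : 0 < Real.sqrt (1 - δ) := Real.sqrt_pos.2 (by linarith)
    -- By Wirtinger, `A ≤ B` for `A = ∫ u²`, `B = ∫ u'²`. Hence `(2/L) A ≤ √A √B`, so the total is
    -- `1 + 4 = 5` times `√A √B`, and `(1 - δ) B ≤ B - δ A`.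
    refine ⟨5 / Real.sqrt (1 - δ), by change (0 : ℝ) ≤ _; positivity, ?_⟩
    intro u g hu h0 x hx
    have hL : 0 < 2 * Real.pi := by positivity
    have h1 := hu.sq_norm_le_mul hL hx
    have hw := hu.wirtinger_real (h0 trivial)
    simp only [Real.norm_eq_abs, sq_abs] at h1
    rw [integral_deriv_sq_add hu]
    have hA : 0 ≤ ∫ t, u t ^ 2 ∂perMeasure (2 * Real.pi) := integral_nonneg fun t => by positivity
    have hB : 0 ≤ ∫ t, g t ^ 2 ∂perMeasure (2 * Real.pi) := integral_nonneg fun t => by positivity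
    set A := ∫ t, u t ^ 2 ∂perMeasure (2 * Real.pi)
    set B := ∫ t, g t ^ 2 ∂perMeasure (2 * Real.pi)
    have h2 : Real.sqrt (1 - δ) * Real.sqrt B ≤ Real.sqrt (B + -δ * A) := by
      rw [← Real.sqrt_mul (by linarith)]
      exact Real.sqrt_le_sqrt (by nlinarith)
    have hsA := Real.sqrt_nonneg A
    have hsw := Real.sqrt_le_sqrt hw
    have h3 : 2 / (2 * Real.pi) * A ≤ Real.sqrt A * Real.sqrt B := by
      have h4 : 2 / (2 * Real.pi) ≤ 1 := by
        rw [div_le_one (by positivity)]; linarith [Real.pi_gt_three]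
      calc 2 / (2 * Real.pi) * A ≤ 1 * A := by gcongr
        _ = Real.sqrt A * Real.sqrt A := by rw [one_mul, Real.mul_self_sqrt hA]
        _ ≤ _ := by gcongr
    calc u x ^ 2 ≤ 5 * (Real.sqrt B * Real.sqrt A) := by linarith
      _ = 5 / Real.sqrt (1 - δ) * (Real.sqrt (1 - δ) * Real.sqrt B) * Real.sqrt A := by
          field_simp
      _ ≤ _ := by gcongr

/-! ### The Lieb–Thirring inequality for orthonormal families -/

/-- Young's inequality with exponents `3` and `3/2`; it is the source of the factor `2/(3√3)`. -/
lemma mul_le_add_rpow_of_cube_le {ν v K a : ℝ} (hν : 0 ≤ ν) (hv : 0 ≤ v) (hK : 0 ≤ K)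
    (h : ν ^ 3 ≤ K ^ 2 * a) (ha : 0 ≤ a) :
    ν * v ≤ a + 2 / (3 * Real.sqrt 3) * K * v ^ (3 / 2 : ℝ) := by
  rcases hK.eq_or_lt with rfl | hK
  · have : ν = 0 := by
      have h1 : ν ^ 3 ≤ 0 := by simpa using h
      exact pow_eq_zero_iff (n := 3) (by norm_num) |>.1 (le_antisymm h1 (by positivity))
    simp [this, ha]
  have h3 : (0 : ℝ) < Real.sqrt 3 := by positivity
  have h33 : Real.sqrt 3 ^ 2 = 3 := Real.sq_sqrt (by norm_num)
  -- With `v = 3r²` and `ν = K t` the claim reduces to `3 t r² ≤ t³ + 2 r³`, that is, `(t - r)² (t +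
  -- 2r) ≥ 0`.
  obtain ⟨r, hr, hvr⟩ : ∃ r, 0 ≤ r ∧ v = 3 * r ^ 2 :=
    ⟨Real.sqrt (v / 3), Real.sqrt_nonneg _, by rw [Real.sq_sqrt (by positivity)]; ring⟩
  have hs : v ^ (3 / 2 : ℝ) = (Real.sqrt 3 * r) ^ 3 := by
    have : v = (Real.sqrt 3 * r) ^ (2 : ℝ) := by
      rw [Real.rpow_two, mul_pow, h33, hvr]
    rw [this, ← Real.rpow_mul (by positivity), ← Real.rpow_natCast]
    norm_num
  obtain ⟨t, ht, hνt⟩ : ∃ t, 0 ≤ t ∧ ν = K * t := ⟨ν / K, by positivity, by field_simp⟩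
  have h4 : K * t ^ 3 ≤ a := by
    rw [hνt] at h
    have : K ^ 2 * (K * t ^ 3) ≤ K ^ 2 * a := by linarith
    exact le_of_mul_le_mul_left this (by positivity)
  have h5 : 2 / (3 * Real.sqrt 3) * K * (Real.sqrt 3 * r) ^ 3 = 2 * K * r ^ 3 := by
    rw [mul_pow, pow_succ, h33]
    field_simp
  rw [hs, h5, hνt, hvr]
  have h6 : 0 ≤ K * ((t - r) ^ 2 * (t + 2 * r)) := by positivity
  nlinarith

lemma IsPerH1.finset_sum {E ι : Type*} [NormedAddCommGroup E] [NormedSpace ℝ E] {L : ℝ}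
    {u g : ι → ℝ → E} (s : Finset ι) (h : ∀ i, IsPerH1 L (u i) (g i)) :
    IsPerH1 L (fun x => ∑ i ∈ s, u i x) fun x => ∑ i ∈ s, g i x := by
  classical
  induction s using Finset.induction_on with
  | empty => simpa using IsPerH1.const (L := L) (0 : E)
  | insert a s ha ih => simpa [Finset.sum_insert ha] using (h a).add ih

section LiebThirring

variable {M : ℕ} {L c K : ℝ} {mz : Prop}

lemma integral_inner_self {u : ℝ → CVec M} :
    ∫ t, ⟪u t, u t⟫_ℂ ∂perMeasure L = ((∫ t, ‖u t‖ ^ 2 ∂perMeasure L : ℝ) : ℂ) := by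
  rw [← integral_complex_ofReal]
  refine integral_congr_ae (Filter.Eventually.of_forall fun t => ?_)
  simp only [inner_self_eq_norm_sq_to_K]
  simp

lemma integral_norm_sq_sum {ι : Type*} [Fintype ι] {u : ι → ℝ → CVec M}
    (hu : ∀ i, MemLp (u i) 2 (perMeasure L)) (ξ : ι → ℂ) :
    ((∫ t, ‖∑ i, ξ i • u i t‖ ^ 2 ∂perMeasure L : ℝ) : ℂ) =
      ∑ i, ∑ j, starRingEnd ℂ (ξ i) * ξ j * ∫ t, ⟪u i t, u j t⟫_ℂ ∂perMeasure L := by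
  rw [← integral_inner_self]
  have hi := fun i j => integrable_inner_of_memLp (hu i) (hu j)
  have h1 : ∀ t, ⟪∑ i, ξ i • u i t, ∑ i, ξ i • u i t⟫_ℂ =
      ∑ i, ∑ j, starRingEnd ℂ (ξ i) * ξ j * ⟪u i t, u j t⟫_ℂ := by
    intro t
    rw [sum_inner]
    refine Finset.sum_congr rfl fun i _ => ?_
    rw [inner_sum]
    refine Finset.sum_congr rfl fun j _ => ?_
    rw [inner_smul_left, inner_smul_right, mul_assoc]
  simp only [h1]
  rw [integral_finsetSum _ fun i _ => integrable_finsetSum _ fun j _ => (hi i j).const_mul _]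
  refine Finset.sum_congr rfl fun i _ => ?_
  rw [integral_finsetSum _ fun j _ => (hi i j).const_mul _]
  exact Finset.sum_congr rfl fun j _ => integral_const_mul _ _

/-- The positivity of the form `∫ |u'|² + c |u|²` on vector-valued periodic functions. -/
def IsNonnegForm (M : ℕ) (L c : ℝ) (mz : Prop) : Prop :=
  ∀ u u' : ℝ → CVec M, IsPerH1 L u u' → (mz → ∫ t, u t ∂perMeasure L = 0) →
    0 ≤ (∫ t, ‖u' t‖ ^ 2 ∂perMeasure L) + c * ∫ t, ‖u t‖ ^ 2 ∂perMeasure L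

/-- Passage from scalar to vector functions. The scalar inequality applied to `Re⟨e, F⟩`, whose
value at `x` is `ν`, gives `ν² ≤ K √a √ν`. The remaining component of `F` has nonnegative energy, so
discarding it only lowers the energy. -/
lemma cube_le_of_isInterpConst (hK0 : 0 ≤ K) (hK : IsInterpConst L c mz K)
    (hpos : IsNonnegForm M L c mz) {F F' : ℝ → CVec M} (hF : IsPerH1 L F F')
    (hF0 : mz → ∫ t, F t ∂perMeasure L = 0) {e : CVec M} (he : ‖e‖ = 1) {x ν : ℝ}
    (hx : x ∈ Icc 0 L) (hν : 0 ≤ ν) (hFx : F x = (ν : ℂ) • e)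
    (hFn : ∫ t, ‖F t‖ ^ 2 ∂perMeasure L = ν) :
    ν ^ 3 ≤ K ^ 2 * ((∫ t, ‖F' t‖ ^ 2 ∂perMeasure L) + c * ∫ t, ‖F t‖ ^ 2 ∂perMeasure L) := by
  -- The admissible constants concern real-valued functions, hence the real part; `T` and `P` are
  -- only real-linear, yet the splitting of `‖v‖²` is still orthogonal.
  let T : CVec M →L[ℝ] ℝ := Complex.reCLM ∘L ((innerSL ℂ e).restrictScalars ℝ)
  let P : CVec M →L[ℝ] CVec M := ContinuousLinearMap.id ℝ _ - T.smulRight e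
  have hT : ∀ v, T v = (⟪e, v⟫_ℂ).re := fun v => rfl
  have hP : ∀ v, P v = v - ((T v : ℝ) : ℂ) • e := fun v => by
    rw [Complex.coe_smul]; rfl
  have hsplit : ∀ v, ‖v‖ ^ 2 = T v ^ 2 + ‖P v‖ ^ 2 := by
    intro v
    rw [hP, @norm_sub_sq ℂ, inner_smul_right, norm_smul, he, Complex.norm_real, mul_one,
      Real.norm_eq_abs, sq_abs]
    have : RCLike.re (((T v : ℝ) : ℂ) * ⟪v, e⟫_ℂ) = T v * T v := by
      rw [RCLike.re_eq_complex_re, Complex.re_ofReal_mul, ← inner_conj_symm v e, Complex.conj_re,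
        hT]
    rw [this]
    ring
  clear_value P T
  have hg := hF.clm T
  have hp := hF.clm P
  have hg0 : mz → ∫ t, T (F t) ∂perMeasure L = 0 := fun h => by
    rw [T.integral_comp_comm hF.integrable, hF0 h, map_zero]
  have hp0 : mz → ∫ t, P (F t) ∂perMeasure L = 0 := fun h => by
    rw [P.integral_comp_comm hF.integrable, hF0 h, map_zero]
  have hint : ∫ t, ‖F t‖ ^ 2 ∂perMeasure L =
      (∫ t, T (F t) ^ 2 ∂perMeasure L) + ∫ t, ‖P (F t)‖ ^ 2 ∂perMeasure L := by
    rw [← integral_add hg.memLp.integrable_sq hp.memLp.norm.integrable_sq]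
    exact integral_congr_ae (Filter.Eventually.of_forall fun t => hsplit _)
  have hint' : ∫ t, ‖F' t‖ ^ 2 ∂perMeasure L =
      (∫ t, T (F' t) ^ 2 ∂perMeasure L) + ∫ t, ‖P (F' t)‖ ^ 2 ∂perMeasure L := by
    rw [← integral_add hg.deriv_memLp.integrable_sq hp.deriv_memLp.norm.integrable_sq]
    exact integral_congr_ae (Filter.Eventually.of_forall fun t => hsplit _)
  have h1 := hK _ _ hg hg0 x hx
  have h2 := hpos _ _ hp hp0
  have h0 := hpos _ _ hF hF0
  have hTx : T (F x) = ν := by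
    rw [hT, hFx, inner_smul_right, inner_self_eq_norm_sq_to_K, he]
    simp
  rw [integral_deriv_sq_add hg, hTx] at h1
  set a := (∫ t, ‖F' t‖ ^ 2 ∂perMeasure L) + c * ∫ t, ‖F t‖ ^ 2 ∂perMeasure L with ha
  have h3 : (∫ t, T (F' t) ^ 2 ∂perMeasure L) + c * ∫ t, T (F t) ^ 2 ∂perMeasure L ≤ a := by
    rw [ha, hint, hint']; linarith
  have h4 : ∫ t, T (F t) ^ 2 ∂perMeasure L ≤ ν := by
    have : 0 ≤ ∫ t, ‖P (F t)‖ ^ 2 ∂perMeasure L := integral_nonneg fun t => by positivity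
    linarith
  have h5 : ν ^ 2 ≤ K * Real.sqrt a * Real.sqrt ν := h1.trans
    (mul_le_mul (mul_le_mul_of_nonneg_left (Real.sqrt_le_sqrt h3) hK0) (Real.sqrt_le_sqrt h4)
      (Real.sqrt_nonneg _) (mul_nonneg hK0 (Real.sqrt_nonneg _)))
  have h6 : (ν ^ 2) ^ 2 ≤ (K * Real.sqrt a * Real.sqrt ν) ^ 2 :=
    pow_le_pow_left₀ (sq_nonneg _) h5 2
  rw [mul_pow, mul_pow, Real.sq_sqrt h0, Real.sq_sqrt hν] at h6
  rcases hν.eq_or_lt with h7 | h7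
  · rw [← h7]
    simpa using mul_nonneg (sq_nonneg K) h0
  · exact le_of_mul_le_mul_right (by linarith) h7

variable {ι : Type*} [Fintype ι] {ψ ψ' : ι → ℝ → CVec M}

/-- The pointwise core of the bound. The estimate is made in an eigenbasis of the density matrix at
`x`, but both sides of the result are independent of that basis, so they can be integrated in `x`.
-/
lemma sum_re_inner_matApply_le [DecidableEq ι] (hK0 : 0 ≤ K) (hK : IsInterpConst L c mz K)
    (hpos : IsNonnegForm M L c mz) (hψ : ∀ i, IsPerH1 L (ψ i) (ψ' i))
    (hψ0 : mz → ∀ i, ∫ t, ψ i t ∂perMeasure L = 0)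
    (hon : ∀ i j, ∫ t, ⟪ψ i t, ψ j t⟫_ℂ ∂perMeasure L = if i = j then 1 else 0)
    {x : ℝ} (hx : x ∈ Icc 0 L) {A : Matrix (Fin M) (Fin M) ℂ} (hA : A.PosSemidef) :
    ∑ i, (⟪ψ i x, matApply A (ψ i x)⟫_ℂ).re ≤
      (∑ i, ∑ j, ((∫ t, ⟪ψ' i t, ψ' j t⟫_ℂ ∂perMeasure L) +
        (c : ℂ) * ∫ t, ⟪ψ i t, ψ j t⟫_ℂ ∂perMeasure L) * ⟪ψ j x, ψ i x⟫_ℂ).re +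
      2 / (3 * Real.sqrt 3) * K * traceRpow A := by
  let U : CVec M →ₗ[ℂ] CVec M := ∑ i, (innerₛₗ ℂ (ψ i x)).smulRight (ψ i x)
  have hU : ∀ v, U v = ∑ i, ⟪ψ i x, v⟫_ℂ • ψ i x := fun v => by
    simp [U, LinearMap.sum_apply]
  have hUs : U.IsSymmetric := by
    intro v w
    rw [hU, hU, sum_inner, inner_sum]
    refine Finset.sum_congr rfl fun i _ => ?_
    rw [inner_smul_left, inner_smul_right, inner_conj_symm, mul_comm]
  obtain ⟨κ, _, b, μ, hb⟩ : ∃ (κ : Type) (_ : Fintype κ) (b : OrthonormalBasis κ ℂ (CVec M))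
      (μ : κ → ℝ), ∀ k, U (b k) = (μ k : ℂ) • b k :=
    ⟨_, inferInstance, hUs.eigenvectorBasis rfl, hUs.eigenvalues rfl,
      hUs.apply_eigenvectorBasis rfl⟩
  have hb1 : ∀ k, ‖b k‖ = 1 := b.orthonormal.1
  have hμ : ∀ k, ((μ k : ℝ) : ℂ) = ∑ i, starRingEnd ℂ ⟪ψ i x, b k⟫_ℂ * ⟪ψ i x, b k⟫_ℂ := by
    intro k
    have h1 : ⟪b k, U (b k)⟫_ℂ = μ k := by
      rw [hb, inner_smul_right, inner_self_eq_norm_sq_to_K, hb1]; simp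
    rw [← h1, hU, inner_sum]
    refine Finset.sum_congr rfl fun i _ => ?_
    rw [inner_smul_right, inner_conj_symm, mul_comm]
  have hμ0 : ∀ k, 0 ≤ μ k := by
    intro k
    have h1 : ((μ k : ℝ) : ℂ) = ((∑ i, ‖⟪ψ i x, b k⟫_ℂ‖ ^ 2 : ℝ) : ℂ) := by
      rw [hμ]; push_cast
      exact Finset.sum_congr rfl fun i _ => Complex.conj_mul' _
    rw [Complex.ofReal_injective h1]
    positivity
  set a : ι → ι → ℂ := fun i j => (∫ t, ⟪ψ' i t, ψ' j t⟫_ℂ ∂perMeasure L) +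
        (c : ℂ) * ∫ t, ⟪ψ i t, ψ j t⟫_ℂ ∂perMeasure L with ha
  -- The coefficients are chosen so that `F k x = U (b k) = μ k • b k`, while orthonormality gives
  -- `‖F k‖² = μ k`.
  let F : κ → ℝ → CVec M := fun k t => ∑ i, ⟪ψ i x, b k⟫_ℂ • ψ i t
  let F' : κ → ℝ → CVec M := fun k t => ∑ i, ⟪ψ i x, b k⟫_ℂ • ψ' i t
  have hF : ∀ k, IsPerH1 L (F k) (F' k) := fun k =>
    IsPerH1.finset_sum Finset.univ fun i => (hψ i).const_smul _
  have hF0 : ∀ k, mz → ∫ t, F k t ∂perMeasure L = 0 := by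
    intro k h
    change ∫ t, ∑ i, ⟪ψ i x, b k⟫_ℂ • ψ i t ∂perMeasure L = 0
    rw [integral_finsetSum _ fun i _ => ((hψ i).const_smul _).integrable]
    refine Finset.sum_eq_zero fun i _ => ?_
    rw [integral_smul, hψ0 h, smul_zero]
  have hFn : ∀ k, ∫ t, ‖F k t‖ ^ 2 ∂perMeasure L = μ k := by
    intro k
    apply Complex.ofReal_injective
    rw [integral_norm_sq_sum fun i => (hψ i).memLp, hμ]
    simp [hon]
  set E : κ → ℝ := fun k => (∫ t, ‖F' k t‖ ^ 2 ∂perMeasure L) +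
    c * ∫ t, ‖F k t‖ ^ 2 ∂perMeasure L with hE
  have hEa : ∀ k, ((E k : ℝ) : ℂ) =
      ∑ i, ∑ j, a i j * (⟪ψ j x, b k⟫_ℂ * ⟪b k, ψ i x⟫_ℂ) := by
    intro k
    rw [hE]
    push_cast
    rw [integral_norm_sq_sum fun i => (hψ i).memLp,
      integral_norm_sq_sum fun i => (hψ i).deriv_memLp, Finset.mul_sum, ← Finset.sum_add_distrib]
    refine Finset.sum_congr rfl fun i _ => ?_
    rw [Finset.mul_sum, ← Finset.sum_add_distrib]
    refine Finset.sum_congr rfl fun j _ => ?_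
    rw [inner_conj_symm, ha]
    ring
  have hcube : ∀ k, μ k ^ 3 ≤ K ^ 2 * E k := fun k =>
    cube_le_of_isInterpConst hK0 hK hpos (hF k) (hF0 k) (hb1 k) hx (hμ0 k)
      (by rw [← hb, hU]) (hFn k)
  have hE0 : ∀ k, 0 ≤ E k := fun k => hpos _ _ (hF k) (hF0 k)
  -- Both sides are the trace of `A U`, computed in the basis `b` on the right.
  have htr : ∑ i, (⟪ψ i x, matApply A (ψ i x)⟫_ℂ).re =
      ∑ k, μ k * (⟪b k, matApply A (b k)⟫_ℂ).re := by
    have h1 : ∑ i, ⟪ψ i x, matApply A (ψ i x)⟫_ℂ =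
        ∑ k, (μ k : ℂ) * ⟪b k, matApply A (b k)⟫_ℂ := by
      have h2 : ∀ k, (μ k : ℂ) * ⟪b k, matApply A (b k)⟫_ℂ =
          ∑ i, ⟪ψ i x, b k⟫_ℂ * ⟪b k, matApply A (ψ i x)⟫_ℂ := by
        intro k
        rw [← inner_smul_right, ← map_smul, ← hb, hU, map_sum, inner_sum]
        refine Finset.sum_congr rfl fun i _ => ?_
        rw [map_smul, inner_smul_right]
      simp only [h2]
      rw [Finset.sum_comm]
      exact Finset.sum_congr rfl fun i _ => (b.sum_inner_mul_inner _ _).symm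
    rw [← Complex.re_sum, h1, Complex.re_sum]
    exact Finset.sum_congr rfl fun k _ => Complex.re_ofReal_mul _ _
  -- Parseval in the basis `b` removes the dependence on `b`.
  have hsumE : ∑ k, E k = (∑ i, ∑ j, a i j * ⟪ψ j x, ψ i x⟫_ℂ).re := by
    rw [← Complex.ofReal_re (∑ k, E k)]
    congr 1
    push_cast
    simp only [hEa]
    rw [Finset.sum_comm]
    refine Finset.sum_congr rfl fun i _ => ?_
    rw [Finset.sum_comm]
    refine Finset.sum_congr rfl fun j _ => ?_
    rw [← Finset.mul_sum, b.sum_inner_mul_inner]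
  rw [htr, ← hsumE]
  calc ∑ k, μ k * (⟪b k, matApply A (b k)⟫_ℂ).re
      ≤ ∑ k, (E k + 2 / (3 * Real.sqrt 3) * K *
          (⟪b k, matApply A (b k)⟫_ℂ).re ^ (3 / 2 : ℝ)) :=
        Finset.sum_le_sum fun k _ => mul_le_add_rpow_of_cube_le (hμ0 k)
          (hA.re_inner_matApply_nonneg _) hK0 (hcube k) (hE0 k)
    _ ≤ _ := by
        rw [Finset.sum_add_distrib, ← Finset.mul_sum]
        gcongr
        exact hA.sum_rpow_le_traceRpow b

lemma sum_integral_inner_matApply_le [DecidableEq ι] (hK0 : 0 ≤ K) (hK : IsInterpConst L c mz K)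
    (hpos : IsNonnegForm M L c mz) (hψ : ∀ i, IsPerH1 L (ψ i) (ψ' i))
    (hψ0 : mz → ∀ i, ∫ t, ψ i t ∂perMeasure L = 0)
    (hon : ∀ i j, ∫ t, ⟪ψ i t, ψ j t⟫_ℂ ∂perMeasure L = if i = j then 1 else 0)
    {V : ℝ → Matrix (Fin M) (Fin M) ℂ} (hV : ∀ᵐ x ∂perMeasure L, (V x).PosSemidef)
    (hVi : Integrable (fun x => traceRpow (V x)) (perMeasure L))
    (hVψ : ∀ i, Integrable (fun x => ⟪ψ i x, matApply (V x) (ψ i x)⟫_ℂ) (perMeasure L)) :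
    ∑ i, (∫ x, ⟪ψ i x, matApply (V x) (ψ i x)⟫_ℂ ∂perMeasure L).re ≤
      ∑ i, ((∫ t, ⟪ψ' i t, ψ' i t⟫_ℂ ∂perMeasure L) +
        (c : ℂ) * ∫ t, ⟪ψ i t, ψ i t⟫_ℂ ∂perMeasure L).re +
      2 / (3 * Real.sqrt 3) * K * ∫ x, traceRpow (V x) ∂perMeasure L := by
  set a : ι → ι → ℂ := fun i j => (∫ t, ⟪ψ' i t, ψ' j t⟫_ℂ ∂perMeasure L) +
        (c : ℂ) * ∫ t, ⟪ψ i t, ψ j t⟫_ℂ ∂perMeasure L with ha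
  have hint : ∀ i j, Integrable (fun x => a i j * ⟪ψ j x, ψ i x⟫_ℂ) (perMeasure L) :=
    fun i j => (integrable_inner_of_memLp (hψ j).memLp (hψ i).memLp).const_mul _
  have hint1 : Integrable (fun x => ∑ i, ∑ j, a i j * ⟪ψ j x, ψ i x⟫_ℂ) (perMeasure L) :=
    integrable_finsetSum _ fun i _ => integrable_finsetSum _ fun j _ => hint i j
  have hre : ∀ f : ℝ → ℂ, Integrable f (perMeasure L) →
      ∫ x, (f x).re ∂perMeasure L = (∫ x, f x ∂perMeasure L).re := fun f hf =>
    Complex.reCLM.integral_comp_comm hf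
  have h1 : ∫ x, ∑ i, (⟪ψ i x, matApply (V x) (ψ i x)⟫_ℂ).re ∂perMeasure L ≤
      ∫ x, ((∑ i, ∑ j, a i j * ⟪ψ j x, ψ i x⟫_ℂ).re +
        2 / (3 * Real.sqrt 3) * K * traceRpow (V x)) ∂perMeasure L := by
    refine integral_mono_ae (integrable_finsetSum _ fun i _ => (hVψ i).re)
      (hint1.re.add (hVi.const_mul _)) ?_
    filter_upwards [hV, ae_restrict_mem measurableSet_Ioc] with x hx hxm
    exact sum_re_inner_matApply_le hK0 hK hpos hψ hψ0 hon (Ioc_subset_Icc_self hxm) hx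
  have hint2 : Integrable (fun x => (∑ i, ∑ j, a i j * ⟪ψ j x, ψ i x⟫_ℂ).re) (perMeasure L) :=
    hint1.re
  have hVre : ∀ i, Integrable (fun x => (⟪ψ i x, matApply (V x) (ψ i x)⟫_ℂ).re) (perMeasure L) :=
    fun i => (hVψ i).re
  rw [integral_finsetSum _ fun i _ => hVre i, integral_add hint2 (hVi.const_mul _),
    integral_const_mul, hre _ hint1, integral_finsetSum _ fun i _ =>
      integrable_finsetSum _ fun j _ => hint i j] at h1
  simp only [hre _ (hVψ _)] at h1
  refine h1.trans (le_of_eq ?_)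
  congr 1
  rw [← Complex.re_sum]
  congr 1
  refine Finset.sum_congr rfl fun i _ => ?_
  rw [integral_finsetSum _ fun j _ => hint i j]
  -- Integration in `x` turns `⟨ψ_j(x), ψ_i(x)⟩` into the Kronecker delta, so only diagonal energies
  -- survive.
  trans a i i
  · simp [integral_const_mul, hon]
  · rfl

end LiebThirring

/-! ### The Hilbert space of periodic `H¹` functions -/

lemma isCompactOperator_of_tendsto_norm_sub {E F : Type*} [NormedAddCommGroup E]
    [NormedSpace ℂ E] [NormedAddCommGroup F] [NormedSpace ℂ F] [CompleteSpace F]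
    {T : ℕ → E →L[ℂ] F} {S : E →L[ℂ] F} (hT : ∀ n, IsCompactOperator (T n))
    (h : Filter.Tendsto (fun n => ‖T n - S‖) Filter.atTop (nhds 0)) : IsCompactOperator S :=
  isCompactOperator_of_tendsto (tendsto_iff_norm_sub_tendsto_zero.2 h)
    (Filter.Eventually.of_forall hT)

section PerSpace

variable {M : ℕ} {L : ℝ}

lemma inner_eq_integral (f g : VecL2 M L) : ⟪f, g⟫_ℂ = ∫ t, ⟪f t, g t⟫_ℂ ∂perMeasure L :=
  L2.inner_def f g

lemma norm_sq_eq_integral (f : VecL2 M L) : ‖f‖ ^ 2 = ∫ t, ‖f t‖ ^ 2 ∂perMeasure L := by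
  have h := inner_self_eq_norm_sq_to_K (𝕜 := ℂ) f
  rw [inner_eq_integral, integral_inner_self] at h
  have h' : ((∫ t, ‖f t‖ ^ 2 ∂perMeasure L : ℝ) : ℂ) = ((‖f‖ ^ 2 : ℝ) : ℂ) := by
    rw [h]; push_cast; rfl
  exact (Complex.ofReal_injective h').symm

lemma integral_norm_le_sqrt_mul (f : VecL2 M L) :
    ∫ t, ‖f t‖ ∂perMeasure L ≤ Real.sqrt L * ‖f‖ := by
  rcases lt_or_ge L 0 with hL | hL
  · have h0 : perMeasure L = 0 := by simp [perMeasure, hL.le]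
    have h1 : ∀ φ : ℝ → ℝ, ∫ t, φ t ∂perMeasure L = 0 := fun φ => by
      rw [h0, integral_zero_measure]
    rw [h1]
    positivity
  · have h := sq_setIntegral_le hL (Lp.memLp f).norm
    rw [sub_zero, ← norm_sq_eq_integral] at h
    rw [← Real.sqrt_sq (norm_nonneg f), ← Real.sqrt_mul hL]
    exact Real.le_sqrt_of_sq_le h

variable (M L) in
/-- The map `g ↦ ∫₀ˣ g`. -/
def primitiveL (x : ℝ) : VecL2 M L →L[ℂ] CVec M :=
  LinearMap.mkContinuous
    { toFun := fun g => ∫ t in Iic x, g t ∂perMeasure L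
      map_add' := fun f g => by
        rw [← integral_add (((Lp.memLp f).integrable one_le_two).restrict)
          (((Lp.memLp g).integrable one_le_two).restrict)]
        exact integral_congr_ae (ae_restrict_of_ae (Lp.coeFn_add f g))
      map_smul' := fun c f => by
        rw [RingHom.id_apply, ← integral_smul]
        exact integral_congr_ae (ae_restrict_of_ae (Lp.coeFn_smul c f)) }
    (Real.sqrt L) fun g => by
      refine (norm_integral_le_integral_norm _).trans (le_trans ?_ (integral_norm_le_sqrt_mul g))
      exact integral_mono_measure Measure.restrict_le_self
        (Filter.Eventually.of_forall fun t => norm_nonneg _)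
        ((Lp.memLp g).integrable one_le_two).norm

lemma primitiveL_apply (x : ℝ) (g : VecL2 M L) :
    primitiveL M L x g = ∫ t in Iic x, g t ∂perMeasure L := rfl

lemma primitiveL_eq {x : ℝ} (hx : x ∈ Icc 0 L) (g : VecL2 M L) :
    primitiveL M L x g = ∫ t in (0 : ℝ)..x, g t := by
  rw [primitiveL_apply, Measure.restrict_restrict measurableSet_Iic, inter_comm, Ioc_inter_Iic,
    min_eq_right hx.2, intervalIntegral.integral_of_le hx.1]

lemma norm_primitiveL_le (x : ℝ) (g : VecL2 M L) : ‖primitiveL M L x g‖ ≤ Real.sqrt L * ‖g‖ :=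
  ContinuousLinearMap.le_of_opNorm_le _ (LinearMap.mkContinuous_norm_le _ (Real.sqrt_nonneg _) _) g

variable (M L) in
/-- The pairs `(c, g)` with `∫ g = 0`. -/
def perSubmodule : Submodule ℂ (WithLp 2 (CVec M × VecL2 M L)) :=
  LinearMap.ker (primitiveL M L L ∘L WithLp.sndL 2 ℂ (CVec M) (VecL2 M L)).toLinearMap

variable (M L) in
/-- The Hilbert space of periodic `H¹` functions `c + ∫₀ˣ g` on `[0, L]`, given by the pairs
`(c, g)` with `∫ g = 0`. -/
def PerSpace : Type := perSubmodule M L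

namespace PerSpace

instance : NormedAddCommGroup (PerSpace M L) :=
  inferInstanceAs (NormedAddCommGroup (perSubmodule M L))

instance : InnerProductSpace ℂ (PerSpace M L) :=
  inferInstanceAs (InnerProductSpace ℂ (perSubmodule M L))

instance : CompleteSpace (PerSpace M L) :=
  (ContinuousLinearMap.isClosed_ker
    (primitiveL M L L ∘L WithLp.sndL 2 ℂ (CVec M) (VecL2 M L))).completeSpace_coe

lemma norm_sq' (q : PerSpace M L) : ‖q‖ ^ 2 = ‖q.1.fst‖ ^ 2 + ‖q.1.snd‖ ^ 2 :=
  WithLp.prod_norm_sq_eq_of_L2 _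

variable (M L) in
/-- The derivative. -/
def derivL : PerSpace M L →L[ℂ] VecL2 M L :=
  LinearMap.mkContinuous
    { toFun := fun q => q.1.snd
      map_add' := fun _ _ => rfl
      map_smul' := fun _ _ => rfl } 1 fun q => by
    rw [one_mul]
    exact (sq_le_sq₀ (norm_nonneg _) (norm_nonneg _)).1
      ((le_add_of_nonneg_left (sq_nonneg _)).trans_eq (norm_sq' q).symm)

variable (M L) in
/-- The value at `0`. -/
def initialL : PerSpace M L →L[ℂ] CVec M :=
  LinearMap.mkContinuous
    { toFun := fun q => q.1.fst
      map_add' := fun _ _ => rfl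
      map_smul' := fun _ _ => rfl } 1 fun q => by
    rw [one_mul]
    exact (sq_le_sq₀ (norm_nonneg _) (norm_nonneg _)).1
      ((le_add_of_nonneg_right (sq_nonneg _)).trans_eq (norm_sq' q).symm)

lemma norm_sq (q : PerSpace M L) : ‖q‖ ^ 2 = ‖initialL M L q‖ ^ 2 + ‖derivL M L q‖ ^ 2 :=
  norm_sq' q

lemma norm_derivL_le (q : PerSpace M L) : ‖derivL M L q‖ ≤ ‖q‖ :=
  (sq_le_sq₀ (norm_nonneg _) (norm_nonneg _)).1
    ((le_add_of_nonneg_left (sq_nonneg _)).trans_eq (norm_sq q).symm)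

lemma norm_initialL_le (q : PerSpace M L) : ‖initialL M L q‖ ≤ ‖q‖ :=
  (sq_le_sq₀ (norm_nonneg _) (norm_nonneg _)).1
    ((le_add_of_nonneg_right (sq_nonneg _)).trans_eq (norm_sq q).symm)

variable (M L) in
/-- Evaluation at a point. -/
def evalL (x : ℝ) : PerSpace M L →L[ℂ] CVec M :=
  initialL M L + primitiveL M L x ∘L derivL M L

lemma evalL_apply (x : ℝ) (q : PerSpace M L) :
    evalL M L x q = initialL M L q + primitiveL M L x (derivL M L q) := rfl

lemma norm_evalL_le (x : ℝ) (q : PerSpace M L) : ‖evalL M L x q‖ ≤ (1 + Real.sqrt L) * ‖q‖ := by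
  rw [evalL_apply, add_mul, one_mul]
  refine (norm_add_le _ _).trans (add_le_add (norm_initialL_le q)
    ((norm_primitiveL_le x _).trans ?_))
  exact mul_le_mul_of_nonneg_left (norm_derivL_le q) (Real.sqrt_nonneg _)

lemma evalL_zero (q : PerSpace M L) :
    evalL M L 0 q = initialL M L q := by
  rw [evalL_apply, primitiveL_apply, Measure.restrict_restrict measurableSet_Iic, inter_comm,
    Ioc_inter_Iic, Ioc_eq_empty (by simp)]
  simp

lemma isPerH1 (q : PerSpace M L) : IsPerH1 L (fun x => evalL M L x q) (derivL M L q) := by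
  refine ⟨Lp.memLp _, fun x hx => ?_, ?_⟩
  · rw [evalL_zero, evalL_apply, primitiveL_eq hx]
  · have h : primitiveL M L L (derivL M L q) = 0 := q.2
    rw [evalL_zero, evalL_apply, h, add_zero]

/-- Functions satisfying `IsPerH1` are unconstrained off `[0, L]` and their derivatives matter only
almost everywhere, so agreement is asserted in exactly this sense. -/
lemma exists_of_isPerH1 {u g : ℝ → CVec M} (hL : 0 ≤ L) (hu : IsPerH1 L u g) :
    ∃ q : PerSpace M L, derivL M L q =ᵐ[perMeasure L] g ∧ ∀ x ∈ Icc 0 L, evalL M L x q = u x := by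
  have hg : hu.deriv_memLp.toLp =ᵐ[perMeasure L] g := hu.deriv_memLp.coeFn_toLp
  have hint : ∀ x ∈ Icc 0 L, primitiveL M L x hu.deriv_memLp.toLp = ∫ t in (0 : ℝ)..x, g t := by
    intro x hx
    rw [primitiveL_eq hx, intervalIntegral.integral_of_le hx.1,
      intervalIntegral.integral_of_le hx.1]
    exact integral_congr_ae (ae_restrict_of_ae_restrict_of_subset (Ioc_subset_Ioc_right hx.2) hg)
  refine ⟨⟨WithLp.toLp 2 (u 0, hu.deriv_memLp.toLp), ?_⟩, hg, fun x hx => ?_⟩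
  · change primitiveL M L L hu.deriv_memLp.toLp = 0
    rw [hint L ⟨hL, le_rfl⟩, ← add_right_inj (u 0), ← hu.eq_primitive L ⟨hL, le_rfl⟩, hu.periodic,
      add_zero]
  · change u 0 + primitiveL M L x hu.deriv_memLp.toLp = u x
    rw [hint x hx, ← hu.eq_primitive x hx]

variable (M L) in
/-- The embedding into `L₂(0, L)`. -/
def toL2 : PerSpace M L →L[ℂ] VecL2 M L :=
  LinearMap.mkContinuous
    { toFun := fun q => (isPerH1 q).memLp.toLp
      map_add' := fun p q => by
        rw [← MemLp.toLp_add]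
        congr 1
        ext1 x
        exact map_add _ _ _
      map_smul' := fun c q => by
        rw [RingHom.id_apply, ← MemLp.toLp_const_smul]
        congr 1
        ext1 x
        exact map_smul _ _ _ }
    (measureUnivNNReal (perMeasure L) ^ (2 : ℝ≥0∞).toReal⁻¹ * (1 + Real.sqrt L)) fun q => by
      rw [mul_assoc]
      refine Lp.norm_le_of_ae_bound (by positivity) ?_
      filter_upwards [(isPerH1 q).memLp.coeFn_toLp] with x hx
      change ‖((isPerH1 q).memLp.toLp : VecL2 M L) x‖ ≤ _
      rw [hx]
      exact norm_evalL_le x q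

lemma coeFn_toL2 (q : PerSpace M L) : toL2 M L q =ᵐ[perMeasure L] fun x => evalL M L x q :=
  (isPerH1 q).memLp.coeFn_toLp

/-! ### Compactness of the embedding into `L₂` -/

/-- The sampling index of a point of `[0, L]`, for `N` intervals of equal length. -/
def sampleIndex (L : ℝ) (N : ℕ) (x : ℝ) : Fin (N + 1) :=
  -- The truncation is inactive on `[0, L]`; the endpoint `L` receives index `N`, hence `N + 1`
  -- values.
  ⟨min ⌊x * N / L⌋₊ N, by omega⟩

lemma measurable_sampleIndex (N : ℕ) : Measurable (sampleIndex L N) := by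
  have h : Measurable fun x : ℝ => min ⌊x * N / L⌋₊ N := by fun_prop
  refine measurable_to_countable' fun k => ?_
  have : sampleIndex L N ⁻¹' {k} = (fun x : ℝ => min ⌊x * N / L⌋₊ N) ⁻¹' {(k : ℕ)} := by
    ext x; simp [sampleIndex, Fin.ext_iff]
  rw [this]
  exact h (measurableSet_singleton _)

lemma sampleIndex_spec {N : ℕ} (hL : 0 < L) (hN : 0 < N) {x : ℝ} (hx : x ∈ Icc 0 L) :
    (sampleIndex L N x : ℕ) * L / N ∈ Icc 0 L ∧ (sampleIndex L N x : ℕ) * L / N ≤ x ∧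
      x - (sampleIndex L N x : ℕ) * L / N ≤ L / N := by
  have hN' : (0 : ℝ) < N := Nat.cast_pos.2 hN
  have h0 : 0 ≤ x * N / L := div_nonneg (mul_nonneg hx.1 hN'.le) hL.le
  have h1 : ⌊x * N / L⌋₊ ≤ N := by
    refine Nat.floor_le_of_le ?_
    rw [div_le_iff₀ hL, mul_comm]
    exact mul_le_mul_of_nonneg_left hx.2 hN'.le
  have h2 : ((sampleIndex L N x : ℕ) : ℝ) = (⌊x * N / L⌋₊ : ℝ) := by
    simp only [sampleIndex, min_eq_left h1]
  have h3 := Nat.floor_le h0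
  have h4 := (Nat.lt_floor_add_one (x * N / L)).le
  rw [h2]
  have h5 : (⌊x * N / L⌋₊ : ℝ) * L / N ≤ x := by
    rw [div_le_iff₀ hN']
    rwa [le_div_iff₀ hL] at h3
  refine ⟨⟨by positivity, h5.trans hx.2⟩, h5, ?_⟩
  rw [div_le_iff₀ hL] at h4
  rw [← sub_nonneg]
  have : L / N - (x - (⌊x * N / L⌋₊ : ℝ) * L / N) = ((⌊x * N / L⌋₊ + 1) * L - x * N) / N := by
    field_simp; ring
  rw [this]
  exact div_nonneg (sub_nonneg.2 h4) hN'.le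

lemma memLp_step (N : ℕ) (v : Fin (N + 1) → CVec M) :
    MemLp (fun x => v (sampleIndex L N x)) 2 (perMeasure L) :=
  MemLp.of_bound ((measurable_of_finite v).comp
    (measurable_sampleIndex N)).aestronglyMeasurable (‖v‖)
    (Filter.Eventually.of_forall fun _ => norm_le_pi_norm v _)

variable (M L) in
/-- The step function with given values on the intervals of a uniform partition. -/
def stepL (N : ℕ) : (Fin (N + 1) → CVec M) →L[ℂ] VecL2 M L :=
  LinearMap.toContinuousLinearMap
    { toFun := fun v => (memLp_step N v).toLp
      map_add' := fun v w => (MemLp.toLp_add (memLp_step N v) (memLp_step N w))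
      map_smul' := fun c v => (MemLp.toLp_const_smul c (memLp_step N v)) }

variable (M) in
-- Sampling at the grid points `k L / N` gives finite-rank operators. The Hölder-`1/2` estimate
-- `sq_dist_le` bounds the pointwise error by `√(L/N) ‖q‖`, so they converge in operator norm.
lemma isCompactOperator_toL2 (hL : 0 < L) : IsCompactOperator (toL2 M L) := by
  let S : ∀ N : ℕ, PerSpace M L →L[ℂ] (Fin (N + 1) → CVec M) := fun N =>
    ContinuousLinearMap.pi fun k => evalL M L ((k : ℕ) * L / N)
  refine isCompactOperator_of_tendsto_norm_sub (T := fun N => stepL M L N ∘L S N)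
    (fun N => (isCompactOperator_of_locallyCompactSpace_rng (stepL M L N)).comp_clm (S N)) ?_
  set D : ℝ := measureUnivNNReal (perMeasure L) ^ (2 : ℝ≥0∞).toReal⁻¹ with hD
  have hD0 : 0 ≤ D := by positivity
  have hbound : ∀ N : ℕ, 0 < N → ‖stepL M L N ∘L S N - toL2 M L‖ ≤ D * Real.sqrt (L / N) := by
    intro N hN
    refine ContinuousLinearMap.opNorm_le_bound _ (by positivity) fun q => ?_
    rw [mul_assoc]
    refine Lp.norm_le_of_ae_bound (by positivity) ?_
    have h1 : (stepL M L N (S N q) : VecL2 M L) =ᵐ[perMeasure L]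
        fun x => S N q (sampleIndex L N x) := (memLp_step N (S N q)).coeFn_toLp
    have h2 := Lp.coeFn_sub (stepL M L N (S N q)) (toL2 M L q)
    filter_upwards [h1, h2, coeFn_toL2 q, ae_restrict_mem measurableSet_Ioc] with x h1 h2 h3 hx
    change ‖(stepL M L N (S N q) - toL2 M L q : VecL2 M L) x‖ ≤ _
    rw [h2, Pi.sub_apply, h1, h3]
    change ‖evalL M L ((sampleIndex L N x : ℕ) * L / N) q - evalL M L x q‖ ≤ _
    obtain ⟨hm, hle, hd⟩ := sampleIndex_spec hL hN (Ioc_subset_Icc_self hx)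
    have h4 := (isPerH1 q).sq_dist_le hm (Ioc_subset_Icc_self hx) hle
    rw [← norm_sq_eq_integral] at h4
    rw [norm_sub_rev, ← Real.sqrt_sq (norm_nonneg q), ← Real.sqrt_mul (by positivity)]
    refine Real.le_sqrt_of_sq_le (h4.trans ?_)
    exact mul_le_mul hd (pow_le_pow_left₀ (norm_nonneg _) (norm_derivL_le q) 2) (by positivity)
      (by positivity)
  have hlim : Filter.Tendsto (fun N : ℕ => D * Real.sqrt (L / N)) Filter.atTop (nhds 0) := by
    have h1 := (Real.continuous_sqrt.tendsto 0).comp (tendsto_const_div_atTop_nhds_zero_nat L)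
    simpa using h1.const_mul D
  refine squeeze_zero' (Filter.Eventually.of_forall fun N => ContinuousLinearMap.opNorm_nonneg _)
    ?_ hlim
  filter_upwards [Filter.eventually_gt_atTop 0] with N hN
  exact hbound N hN

end PerSpace

/-! ### The quadratic form -/

variable {V : ℝ → Matrix (Fin M) (Fin M) ℂ}

lemma integrable_card_add_traceRpow (hVi : Integrable (fun x => traceRpow (V x)) (perMeasure L)) :
    Integrable (fun x => M + traceRpow (V x)) (perMeasure L) :=
  (integrable_const _).add hVi

lemma integrable_inner_matApply (hVm : AEStronglyMeasurable V (perMeasure L))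
    (hV : ∀ᵐ x ∂perMeasure L, (V x).PosSemidef)
    (hVi : Integrable (fun x => traceRpow (V x)) (perMeasure L)) {u g v h : ℝ → CVec M}
    (hu : IsPerH1 L u g) (hv : IsPerH1 L v h) :
    Integrable (fun x => ⟪v x, matApply (V x) (u x)⟫_ℂ) (perMeasure L) := by
  obtain ⟨C, hC⟩ := isCompact_Icc.exists_bound_of_continuousOn hu.continuousOn
  obtain ⟨D, hD⟩ := isCompact_Icc.exists_bound_of_continuousOn hv.continuousOn
  have hcont : Continuous fun p : Matrix (Fin M) (Fin M) ℂ × CVec M => matApply p.1 p.2 := by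
    refine (PiLp.continuous_toLp 2 _).comp ?_
    exact Continuous.matrix_mulVec continuous_fst ((PiLp.continuous_ofLp 2 _).comp continuous_snd)
  refine ((integrable_card_add_traceRpow hVi).mul_const (D * C)).mono' ?_ ?_
  · have h1 : AEStronglyMeasurable (fun x => (V x, u x)) (perMeasure L) := hVm.prodMk hu.memLp.1
    have h2 := hcont.comp_aestronglyMeasurable h1
    exact AEStronglyMeasurable.inner (𝕜 := ℂ) hv.memLp.1 h2
  · filter_upwards [hV, ae_restrict_mem measurableSet_Ioc] with x hx hxm
    have h0 : 0 ≤ (M : ℝ) + traceRpow (V x) := add_nonneg (Nat.cast_nonneg _) hx.traceRpow_nonneg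
    refine (hx.norm_inner_matApply_le _ _).trans (mul_le_mul_of_nonneg_left ?_ h0)
    have hxm' := Ioc_subset_Icc_self hxm
    exact mul_le_mul (hD x hxm') (hC x hxm') (norm_nonneg _) ((norm_nonneg _).trans (hD x hxm'))

lemma norm_integral_inner_matApply_le (hV : ∀ᵐ x ∂perMeasure L, (V x).PosSemidef)
    (hVi : Integrable (fun x => traceRpow (V x)) (perMeasure L)) {u v : ℝ → CVec M} {C D : ℝ}
    (hu : ∀ x ∈ Icc 0 L, ‖u x‖ ≤ C) (hv : ∀ x ∈ Icc 0 L, ‖v x‖ ≤ D) :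
    ‖∫ x, ⟪v x, matApply (V x) (u x)⟫_ℂ ∂perMeasure L‖ ≤
      (∫ x, (M + traceRpow (V x)) ∂perMeasure L) * (D * C) := by
  rw [← integral_mul_const]
  refine norm_integral_le_of_norm_le ((integrable_card_add_traceRpow hVi).mul_const (D * C)) ?_
  filter_upwards [hV, ae_restrict_mem measurableSet_Ioc] with x hx hxm
  have h0 : 0 ≤ (M : ℝ) + traceRpow (V x) := add_nonneg (Nat.cast_nonneg _) hx.traceRpow_nonneg
  refine (hx.norm_inner_matApply_le _ _).trans (mul_le_mul_of_nonneg_left ?_ h0)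
  have hxm' := Ioc_subset_Icc_self hxm
  exact mul_le_mul (hv x hxm') (hu x hxm') (norm_nonneg _) ((norm_nonneg _).trans (hv x hxm'))

lemma integral_card_add_traceRpow_nonneg (hV : ∀ᵐ x ∂perMeasure L, (V x).PosSemidef) :
    0 ≤ ∫ x, (M + traceRpow (V x)) ∂perMeasure L :=
  integral_nonneg_of_ae (hV.mono fun _ hx => add_nonneg (Nat.cast_nonneg _) hx.traceRpow_nonneg)

namespace PerSpace

/-- The form `∫ ⟨v, V u⟩`. -/
def potentialForm (hVm : AEStronglyMeasurable V (perMeasure L))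
    (hV : ∀ᵐ x ∂perMeasure L, (V x).PosSemidef)
    (hVi : Integrable (fun x => traceRpow (V x)) (perMeasure L)) :
    PerSpace M L →L⋆[ℂ] PerSpace M L →L[ℂ] ℂ :=
  LinearMap.mkContinuous₂
    (LinearMap.mk₂'ₛₗ (starRingEnd ℂ) (RingHom.id ℂ)
      (fun v u => ∫ x, ⟪evalL M L x v, matApply (V x) (evalL M L x u)⟫_ℂ ∂perMeasure L)
      (fun v w u => by
        simp only [map_add, inner_add_left]
        exact integral_add (integrable_inner_matApply hVm hV hVi (isPerH1 u) (isPerH1 v))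
          (integrable_inner_matApply hVm hV hVi (isPerH1 u) (isPerH1 w)))
      (fun c v u => by
        simp only [map_smul, inner_smul_left]
        exact integral_const_mul _ _)
      (fun v u w => by
        simp only [map_add, inner_add_right]
        exact integral_add (integrable_inner_matApply hVm hV hVi (isPerH1 u) (isPerH1 v))
          (integrable_inner_matApply hVm hV hVi (isPerH1 w) (isPerH1 v)))
      (fun c v u => by
        simp only [map_smul, inner_smul_right]
        exact integral_const_mul _ _))
    ((∫ x, (M + traceRpow (V x)) ∂perMeasure L) * (1 + Real.sqrt L) ^ 2) fun v u => by
      refine (norm_integral_inner_matApply_le hV hVi (fun x _ => norm_evalL_le x u)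
        (fun x _ => norm_evalL_le x v)).trans (le_of_eq ?_)
      ring

/-- The form `∫ ⟨v', u'⟩ + c ∫ ⟨v, u⟩ - ∫ ⟨v, V u⟩`. -/
def schrForm (c : ℝ) (hVm : AEStronglyMeasurable V (perMeasure L))
    (hV : ∀ᵐ x ∂perMeasure L, (V x).PosSemidef)
    (hVi : Integrable (fun x => traceRpow (V x)) (perMeasure L)) :
    PerSpace M L →L⋆[ℂ] PerSpace M L →L[ℂ] ℂ :=
  (innerSL ℂ).bilinearComp (derivL M L) (derivL M L) +
    (c : ℂ) • (innerSL ℂ).bilinearComp (toL2 M L) (toL2 M L) - potentialForm hVm hV hVi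

variable {c : ℝ} {hVm : AEStronglyMeasurable V (perMeasure L)}
  {hV : ∀ᵐ x ∂perMeasure L, (V x).PosSemidef}
  {hVi : Integrable (fun x => traceRpow (V x)) (perMeasure L)}

lemma schrForm_apply (p q : PerSpace M L) : schrForm c hVm hV hVi p q =
    ⟪derivL M L p, derivL M L q⟫_ℂ + (c : ℂ) * ⟪toL2 M L p, toL2 M L q⟫_ℂ -
      ∫ x, ⟪evalL M L x p, matApply (V x) (evalL M L x q)⟫_ℂ ∂perMeasure L := rfl

/-- The dictionary between the abstract form and the integrals in the weak formulation. -/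
lemma schrForm_eq {u g v h : ℝ → CVec M} {p q : PerSpace M L}
    (hp : derivL M L p =ᵐ[perMeasure L] h) (hpv : ∀ x ∈ Icc 0 L, evalL M L x p = v x)
    (hq : derivL M L q =ᵐ[perMeasure L] g) (hqu : ∀ x ∈ Icc 0 L, evalL M L x q = u x) :
    schrForm c hVm hV hVi p q = (∫ x, ⟪h x, g x⟫_ℂ ∂perMeasure L) +
      (c : ℂ) * (∫ x, ⟪v x, u x⟫_ℂ ∂perMeasure L) -
      ∫ x, ⟪v x, matApply (V x) (u x)⟫_ℂ ∂perMeasure L := by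
  have hmem := ae_restrict_mem (μ := volume) (measurableSet_Ioc (a := (0 : ℝ)) (b := L))
  rw [schrForm_apply, inner_eq_integral, inner_eq_integral]
  refine congrArg₂ (· - ·) (congrArg₂ (· + ·) ?_ (congrArg _ ?_)) ?_
  · refine integral_congr_ae ?_
    filter_upwards [hp, hq] with x h1 h2
    rw [h1, h2]
  · refine integral_congr_ae ?_
    filter_upwards [coeFn_toL2 p, coeFn_toL2 q, hmem] with x h1 h2 hx
    rw [h1, h2, hpv x (Ioc_subset_Icc_self hx), hqu x (Ioc_subset_Icc_self hx)]
  · refine integral_congr_ae ?_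
    filter_upwards [hmem] with x hx
    rw [hpv x (Ioc_subset_Icc_self hx), hqu x (Ioc_subset_Icc_self hx)]

lemma schrForm_conj (p q : PerSpace M L) :
    schrForm c hVm hV hVi q p = starRingEnd ℂ (schrForm c hVm hV hVi p q) := by
  rw [schrForm_apply, schrForm_apply, map_sub, map_add, map_mul, inner_conj_symm, inner_conj_symm,
    Complex.conj_ofReal, ← integral_conj]
  congr 1
  refine integral_congr_ae ?_
  filter_upwards [hV] with x hx
  have hs : (Matrix.toEuclideanLin (V x)).IsSymmetric :=
    Matrix.isSymmetric_toEuclideanLin_iff.2 hx.1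
  rw [inner_conj_symm, ← hs]

/-- The `L₁` potential costs at most its mass `W` times `sup ‖u‖²`, and the window inequality with a
short window makes the derivative part of this at most half of `∫ ‖u'‖²`. -/
lemma exists_coercive (hL : 0 < L) : ∃ l d : ℝ, 0 < d ∧ ∀ q : PerSpace M L,
    d * ‖q‖ ^ 2 ≤ (schrForm c hVm hV hVi q q).re + l * ‖toL2 M L q‖ ^ 2 := by
  set W := ∫ x, (M + traceRpow (V x)) ∂perMeasure L with hW
  have hW0 : 0 ≤ W := integral_card_add_traceRpow_nonneg hV
  obtain ⟨r, hr, hrL, hrW⟩ : ∃ r, 0 < r ∧ r ≤ L ∧ W * (2 * r) ≤ 1 / 2 := by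
    refine ⟨min L (1 / (4 * (W + 1))), lt_min hL (by positivity), min_le_left _ _, ?_⟩
    calc W * (2 * min L (1 / (4 * (W + 1)))) ≤ (W + 1) * (2 * (1 / (4 * (W + 1)))) := by
          gcongr
          · linarith
          · exact min_le_right _ _
      _ = 1 / 2 := by field_simp; norm_num
  -- `d` is chosen so that `d ‖q‖²` consumes the other half of the derivative term; `l` then absorbs
  -- every multiple of the `L₂` norm.
  set d : ℝ := 1 / (2 * (2 * L + 1)) with hd
  have hd0 : 0 < d := by positivity
  refine ⟨-c + W * (2 / r) + d * (2 / L), d, hd0, fun q => ?_⟩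
  have hB := norm_sq_eq_integral (derivL M L q)
  have hA : ‖toL2 M L q‖ ^ 2 = ∫ t, ‖evalL M L t q‖ ^ 2 ∂perMeasure L := by
    rw [norm_sq_eq_integral]
    exact integral_congr_ae ((coeFn_toL2 q).mono fun x hx => by simp only [hx])
  have hsup : ∀ x ∈ Icc 0 L, ∀ s, 0 < s → s ≤ L →
      ‖evalL M L x q‖ ^ 2 ≤ 2 / s * ‖toL2 M L q‖ ^ 2 + 2 * s * ‖derivL M L q‖ ^ 2 := by
    intro x hx s hs hsL
    have := (isPerH1 q).sq_norm_le hx hs hsL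
    rwa [← hA, ← hB] at this
  set A := ‖toL2 M L q‖ ^ 2 with hAdef
  set B := ‖derivL M L q‖ ^ 2 with hBdef
  have hA0 : 0 ≤ A := by positivity
  have hB0 : 0 ≤ B := by positivity
  clear_value A B
  have h1 : ‖q‖ ^ 2 ≤ 2 / L * A + (2 * L + 1) * B := by
    have := hsup 0 ⟨le_rfl, hL.le⟩ L hL le_rfl
    rw [evalL_zero] at this
    rw [norm_sq q, ← hBdef]
    linarith
  set R := 2 / r * A + 2 * r * B with hR
  have hR0 : 0 ≤ R := by positivity
  have h2 : (∫ x, ⟪evalL M L x q, matApply (V x) (evalL M L x q)⟫_ℂ ∂perMeasure L).re ≤ W * R := by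
    have hs : ∀ x ∈ Icc 0 L, ‖evalL M L x q‖ ≤ Real.sqrt R := fun x hx =>
      Real.le_sqrt_of_sq_le (hsup x hx r hr hrL)
    have := norm_integral_inner_matApply_le hV hVi hs hs
    rw [Real.mul_self_sqrt hR0] at this
    exact (Complex.re_le_norm _).trans this
  have h3 : (schrForm c hVm hV hVi q q).re = B + c * A -
      (∫ x, ⟪evalL M L x q, matApply (V x) (evalL M L x q)⟫_ℂ ∂perMeasure L).re := by
    have e1 : (⟪derivL M L q, derivL M L q⟫_ℂ).re = B :=
      (inner_self_eq_norm_sq (𝕜 := ℂ) _).trans hBdef.symm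
    have e2 : (⟪toL2 M L q, toL2 M L q⟫_ℂ).re = A :=
      (inner_self_eq_norm_sq (𝕜 := ℂ) _).trans hAdef.symm
    rw [schrForm_apply, Complex.sub_re, Complex.add_re, Complex.re_ofReal_mul, e1, e2]
  rw [h3]
  have h4 : W * R = W * (2 / r) * A + W * (2 * r) * B := by rw [hR]; ring
  have h5 : d * (2 * L + 1) = 1 / 2 := by rw [hd]; field_simp
  have h6 : d * ‖q‖ ^ 2 ≤ d * (2 / L) * A + 1 / 2 * B := by
    calc d * ‖q‖ ^ 2 ≤ d * (2 / L * A + (2 * L + 1) * B) := by gcongr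
      _ = d * (2 / L) * A + d * (2 * L + 1) * B := by ring
      _ = _ := by rw [h5]
  have h7 : W * (2 * r) * B ≤ 1 / 2 * B := by gcongr
  linarith

end PerSpace

end PerSpace

/-! ### Spectra of the two operators -/

lemma hasDiscreteSpectrum_and_negEigenvalueSum_le {Q H : Type*} [NormedAddCommGroup H]
    [InnerProductSpace ℂ H] [CompleteSpace H] [NormedAddCommGroup Q] [InnerProductSpace ℂ Q]
    [CompleteSpace Q] {A : H →ₗ.[ℂ] H} {J : Q →L[ℂ] H} (hJ : IsCompactOperator J)
    (b : Q →L⋆[ℂ] Q →L[ℂ] ℂ) (hb : ∀ u v, b v u = starRingEnd ℂ (b u v))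
    (hcoer : ∃ l d : ℝ, 0 < d ∧ ∀ u, d * ‖u‖ ^ 2 ≤ (b u u).re + l * ‖J u‖ ^ 2)
    (hG : ∀ p, p ∈ A.graph ↔ ∃ u, p.1 = J u ∧ ∀ v, b v u = ⟪J v, p.2⟫_ℂ) {C : ℝ}
    (h : ∀ (ι : Type) [Fintype ι] (q : ι → Q) (e : ι → ℝ), Orthonormal ℂ (fun i => J (q i)) →
      (∀ i, b (q i) (q i) = e i) → ∑ i, -e i ≤ C) :
    HasDiscreteSpectrum A ∧ negEigenvalueSum A ≤ ENNReal.ofReal C := by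
  obtain ⟨l, d, hd, hcoer⟩ := hcoer
  obtain ⟨T, hT, hTs, hTG⟩ := exists_compact_resolvent hJ b hb l hd hcoer
  have hA : HasDiscreteSpectrum A :=
    hasDiscreteSpectrum_of_graph hT hTs l fun w f => (hG _).trans (hTG w f)
  refine ⟨hA, negEigenvalueSum_le hA (fun p hp p' hp' => ?_) fun ι _ w e hw hwe => ?_⟩
  · obtain ⟨u, hu, hu'⟩ := (hG p).1 hp
    obtain ⟨v, hv, hv'⟩ := (hG p').1 hp'
    rw [hu, hv, ← hv', hb, hu', inner_conj_symm]
  · choose q hq hq' using fun i => (hG _).1 (hwe i)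
    simp only at hq hq'
    obtain rfl : w = fun i => J (q i) := funext hq
    -- For a normalised eigenvector `J q`, testing the weak equation with `q` itself gives `b(q, q)
    -- = e`.
    refine h ι q e hw fun i => ?_
    rw [hq', inner_smul_right, inner_self_eq_norm_sq_to_K, hw.1 i]
    simp

namespace PerSpace

variable {M : ℕ} {L : ℝ}

lemma inner_toL2 {p : PerSpace M L} {v : ℝ → CVec M} (hp : ∀ x ∈ Icc 0 L, evalL M L x p = v x)
    (f : VecL2 M L) : ⟪toL2 M L p, f⟫_ℂ = ∫ x, ⟪v x, f x⟫_ℂ ∂perMeasure L := by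
  rw [inner_eq_integral]
  refine integral_congr_ae ?_
  filter_upwards [coeFn_toL2 p, ae_restrict_mem measurableSet_Ioc] with x h1 hx
  rw [h1, hp x (Ioc_subset_Icc_self hx)]

lemma eq_toL2 {p : PerSpace M L} {v : ℝ → CVec M} (hp : ∀ x ∈ Icc 0 L, evalL M L x p = v x)
    {f : VecL2 M L} (hf : f =ᵐ[perMeasure L] v) : f = toL2 M L p := by
  refine Lp.ext ?_
  filter_upwards [coeFn_toL2 p, hf, ae_restrict_mem measurableSet_Ioc] with x h1 h2 hx
  rw [h1, h2, hp x (Ioc_subset_Icc_self hx)]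

variable {V : ℝ → Matrix (Fin M) (Fin M) ℂ} {c : ℝ}
  {hVm : AEStronglyMeasurable V (perMeasure L)}
  {hV : ∀ᵐ x ∂perMeasure L, (V x).PosSemidef}
  {hVi : Integrable (fun x => traceRpow (V x)) (perMeasure L)}

/-- The form value `e i` is energy minus potential, so `-∑ e i` is exactly the difference bounded by
`sum_integral_inner_matApply_le`. -/
lemma sum_neg_le {K : ℝ} {mz : Prop} (hK0 : 0 ≤ K) (hK : IsInterpConst L c mz K)
    (hpos : IsNonnegForm M L c mz) {ι : Type*} [Fintype ι] (q : ι → PerSpace M L) (e : ι → ℝ)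
    (hq0 : mz → ∀ i, ∫ x, toL2 M L (q i) x ∂perMeasure L = 0)
    (hon : Orthonormal ℂ fun i => toL2 M L (q i))
    (he : ∀ i, schrForm c hVm hV hVi (q i) (q i) = e i) :
    ∑ i, -e i ≤ 2 / (3 * Real.sqrt 3) * K * ∫ x, traceRpow (V x) ∂perMeasure L := by
  classical
  have hon' : ∀ i j, ∫ t, ⟪evalL M L t (q i), evalL M L t (q j)⟫_ℂ ∂perMeasure L =
      if i = j then 1 else 0 := by
    intro i j
    rw [← orthonormal_iff_ite.1 hon i j, inner_toL2 fun _ _ => rfl]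
    refine integral_congr_ae ?_
    filter_upwards [coeFn_toL2 (q j)] with x hx
    rw [hx]
  have h := sum_integral_inner_matApply_le hK0 hK hpos (fun i => isPerH1 (q i))
    (fun h i => by rw [← hq0 h i]; exact (integral_congr_ae (coeFn_toL2 (q i))).symm)
    hon' hV hVi fun i => integrable_inner_matApply hVm hV hVi (isPerH1 (q i)) (isPerH1 (q i))
  have h1 : ∀ i, -e i =
      (∫ x, ⟪evalL M L x (q i), matApply (V x) (evalL M L x (q i))⟫_ℂ ∂perMeasure L).re -
      ((∫ t, ⟪derivL M L (q i) t, derivL M L (q i) t⟫_ℂ ∂perMeasure L) +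
        (c : ℂ) * ∫ t, ⟪evalL M L t (q i), evalL M L t (q i)⟫_ℂ ∂perMeasure L).re := by
    intro i
    have h2 := schrForm_eq (c := c) (hVm := hVm) (hV := hV) (hVi := hVi) (p := q i) (q := q i)
      Filter.EventuallyEq.rfl (fun _ _ => rfl) Filter.EventuallyEq.rfl (fun _ _ => rfl)
    rw [he] at h2
    rw [← Complex.ofReal_re (e i), h2, Complex.sub_re, neg_sub]
  rw [Finset.sum_congr rfl fun i _ => h1 i, Finset.sum_sub_distrib]
  linarith

end PerSpace

open PerSpace

section

variable {M : ℕ} {V : ℝ → Matrix (Fin M) (Fin M) ℂ}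

lemma mem_graph_schrOp1_iff {α β : ℝ} (hα : 0 < α)
    (hVm : AEStronglyMeasurable V (perMeasure (2 * Real.pi / α)))
    (hV : ∀ᵐ x ∂perMeasure (2 * Real.pi / α), (V x).PosSemidef)
    (hVi : Integrable (fun x => traceRpow (V x)) (perMeasure (2 * Real.pi / α)))
    (p : VecL2 M (2 * Real.pi / α) × VecL2 M (2 * Real.pi / α)) :
    p ∈ (schrOp1 α β V).graph ↔ ∃ q, p.1 = toL2 M (2 * Real.pi / α) q ∧
      ∀ r, schrForm (α ^ 2 * β) hVm hV hVi r q = ⟪toL2 M (2 * Real.pi / α) r, p.2⟫_ℂ := by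
  have hL : 0 ≤ 2 * Real.pi / α := by positivity
  rw [schrOp1_graph hα]
  constructor
  · rintro ⟨u, u', hu, hpu, hp⟩
    obtain ⟨q, hq', hq⟩ := exists_of_isPerH1 hL hu
    refine ⟨q, eq_toL2 hq hpu, fun r => ?_⟩
    rw [schrForm_eq (p := r) Filter.EventuallyEq.rfl (fun _ _ => rfl) hq' hq,
      inner_toL2 fun _ _ => rfl]
    exact (hp _ _ (isPerH1 r)).2
  · rintro ⟨q, hq, h⟩
    refine ⟨_, _, isPerH1 q, ?_, fun v v' hv => ⟨?_, ?_⟩⟩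
    · rw [hq]; exact coeFn_toL2 q
    · exact integrable_inner_matApply hVm hV hVi (isPerH1 q) hv
    · obtain ⟨r, hr', hr⟩ := exists_of_isPerH1 hL hv
      rw [← inner_toL2 hr, ← h, schrForm_eq hr' hr Filter.EventuallyEq.rfl (fun _ _ => rfl)]

lemma schrOp1_spectrum {α β : ℝ} (hα : 0 < α) (hβ : 0 < β)
    (hVm : AEStronglyMeasurable V (perMeasure (2 * Real.pi / α)))
    (hV : ∀ᵐ x ∂perMeasure (2 * Real.pi / α), (V x).PosSemidef)
    (hVi : Integrable (fun x => traceRpow (V x)) (perMeasure (2 * Real.pi / α))) :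
    HasDiscreteSpectrum (schrOp1 α β V) ∧ negEigenvalueSum (schrOp1 α β V) ≤
      ENNReal.ofReal (2 / (3 * Real.sqrt 3) * sharpK1 β *
        ∫ x, traceRpow (V x) ∂perMeasure (2 * Real.pi / α)) := by
  have hL : 0 < 2 * Real.pi / α := by positivity
  obtain ⟨hK0, hK⟩ := sharpK1_spec hβ
  have hconj := fun u v : PerSpace M (2 * Real.pi / α) =>
    schrForm_conj (c := α ^ 2 * β) (hVm := hVm) (hV := hV) (hVi := hVi) u v
  have hcoer := exists_coercive (c := α ^ 2 * β) (hVm := hVm) (hV := hV) (hVi := hVi) hL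
  have hG := mem_graph_schrOp1_iff (β := β) hα hVm hV hVi
  refine hasDiscreteSpectrum_and_negEigenvalueSum_le (isCompactOperator_toL2 M hL) _ hconj hcoer hG
    fun ι _ q e hon he => ?_
  refine sum_neg_le hK0 (hK α hα) (fun u u' _ _ => ?_) q e False.elim hon he
  have h1 : 0 ≤ ∫ t, ‖u' t‖ ^ 2 ∂perMeasure (2 * Real.pi / α) :=
    integral_nonneg fun t => by positivity
  have h2 : 0 ≤ ∫ t, ‖u t‖ ^ 2 ∂perMeasure (2 * Real.pi / α) :=
    integral_nonneg fun t => by positivity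
  positivity

/-! #### The mean-zero operator -/

lemma mem_meanZeroL2 {f : VecL2 M (2 * Real.pi)} :
    f ∈ MeanZeroL2 M ↔ ∫ t, f t ∂perMeasure (2 * Real.pi) = 0 := Iff.rfl

lemma isClosed_meanZeroL2 (M : ℕ) : IsClosed (MeanZeroL2 M : Set (VecL2 M (2 * Real.pi))) := by
  have h : (MeanZeroL2 M : Set (VecL2 M (2 * Real.pi))) =
      primitiveL M (2 * Real.pi) (2 * Real.pi) ⁻¹' {0} := by
    ext f
    rw [SetLike.mem_coe, mem_meanZeroL2, mem_preimage, mem_singleton_iff, primitiveL_apply,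
      Measure.restrict_restrict measurableSet_Iic, inter_comm, Ioc_inter_Iic, min_self]
  rw [h]
  exact isClosed_singleton.preimage (ContinuousLinearMap.continuous _)

instance : CompleteSpace (MeanZeroL2 M) := (isClosed_meanZeroL2 M).completeSpace_coe

variable (M) in
/-- The periodic `H¹` functions of mean zero. -/
def MeanZeroPerSpace : Submodule ℂ (PerSpace M (2 * Real.pi)) :=
  (MeanZeroL2 M).comap (toL2 M (2 * Real.pi)).toLinearMap

instance : CompleteSpace (MeanZeroPerSpace M) :=
  ((isClosed_meanZeroL2 M).preimage (toL2 M (2 * Real.pi)).continuous).completeSpace_coe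

variable (M) in
/-- The embedding of the mean-zero periodic `H¹` functions into the mean-zero `L₂` functions. -/
def toMeanZeroL2 : MeanZeroPerSpace M →L[ℂ] MeanZeroL2 M :=
  (toL2 M (2 * Real.pi) ∘L (MeanZeroPerSpace M).subtypeL).codRestrict (MeanZeroL2 M)
    fun q => q.2

lemma isCompactOperator_toMeanZeroL2 : IsCompactOperator (toMeanZeroL2 M) :=
  ((isCompactOperator_toL2 M (by positivity)).comp_clm (MeanZeroPerSpace M).subtypeL).codRestrict
    (fun q => q.2) (isClosed_meanZeroL2 M)

/-- On mean-zero functions the projection disappears, so the second form is a restriction of the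
first with `c = -δ`. -/
lemma meanFree_eq_self {u : ℝ → CVec M} (h : ∫ t, u t ∂perMeasure (2 * Real.pi) = 0) :
    meanFree u = u := by
  ext1 x
  rw [meanFree, h, smul_zero, sub_zero]

lemma mem_meanZeroPerSpace {q : PerSpace M (2 * Real.pi)} {u : ℝ → CVec M}
    (hq : ∀ x ∈ Icc 0 (2 * Real.pi), evalL M (2 * Real.pi) x q = u x) :
    q ∈ MeanZeroPerSpace M ↔ ∫ t, u t ∂perMeasure (2 * Real.pi) = 0 := by
  have : ∫ t, toL2 M (2 * Real.pi) q t ∂perMeasure (2 * Real.pi) =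
      ∫ t, u t ∂perMeasure (2 * Real.pi) := by
    refine integral_congr_ae ?_
    filter_upwards [coeFn_toL2 q, ae_restrict_mem measurableSet_Ioc] with x h1 hx
    rw [h1, hq x (Ioc_subset_Icc_self hx)]
  rw [← this]
  exact Iff.rfl

/-- The form `∫ ⟨v', u'⟩ - δ ∫ ⟨v, u⟩ - ∫ ⟨v, V u⟩` on mean-zero functions. -/
def meanZeroForm (δ : ℝ) (hVm : AEStronglyMeasurable V (perMeasure (2 * Real.pi)))
    (hV : ∀ᵐ x ∂perMeasure (2 * Real.pi), (V x).PosSemidef)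
    (hVi : Integrable (fun x => traceRpow (V x)) (perMeasure (2 * Real.pi))) :
    MeanZeroPerSpace M →L⋆[ℂ] MeanZeroPerSpace M →L[ℂ] ℂ :=
  (schrForm (-δ) hVm hV hVi).bilinearComp (MeanZeroPerSpace M).subtypeL
    (MeanZeroPerSpace M).subtypeL

lemma mem_graph_schrOp2_iff {δ : ℝ} (hVm : AEStronglyMeasurable V (perMeasure (2 * Real.pi)))
    (hV : ∀ᵐ x ∂perMeasure (2 * Real.pi), (V x).PosSemidef)
    (hVi : Integrable (fun x => traceRpow (V x)) (perMeasure (2 * Real.pi)))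
    (p : MeanZeroL2 M × MeanZeroL2 M) :
    p ∈ (schrOp2 δ V).graph ↔ ∃ q, p.1 = toMeanZeroL2 M q ∧
      ∀ r, meanZeroForm δ hVm hV hVi r q = ⟪toMeanZeroL2 M r, p.2⟫_ℂ := by
  have hL : 0 ≤ 2 * Real.pi := by positivity
  have hinner : ∀ (r : MeanZeroPerSpace M) (f : MeanZeroL2 M), ⟪toMeanZeroL2 M r, f⟫_ℂ =
      ⟪toL2 M (2 * Real.pi) r, (f : VecL2 M (2 * Real.pi))⟫_ℂ := fun r f => rfl
  have hform : ∀ r q : MeanZeroPerSpace M, meanZeroForm δ hVm hV hVi r q =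
      schrForm (-δ) hVm hV hVi r q := fun r q => rfl
  simp only [hform]
  rw [schrOp2_graph]
  constructor
  · rintro ⟨u, u', hu, hpu, hp⟩
    obtain ⟨q, hq', hq⟩ := exists_of_isPerH1 hL hu
    -- The graph does not ask `u` to have mean zero; this follows because `p.1` lies in the
    -- mean-zero subspace.
    have hu0 : ∫ t, u t ∂perMeasure (2 * Real.pi) = 0 := by
      rw [← integral_congr_ae hpu]; exact p.1.2
    refine ⟨⟨q, (mem_meanZeroPerSpace hq).2 hu0⟩, Subtype.ext (eq_toL2 hq hpu), fun r => ?_⟩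
    have hr0 := (mem_meanZeroPerSpace (q := (r : PerSpace M (2 * Real.pi))) fun _ _ => rfl).1 r.2
    have h := (hp _ _ (isPerH1 (r : PerSpace M (2 * Real.pi))) hr0).2
    rw [meanFree_eq_self hr0, meanFree_eq_self hu0] at h
    rw [schrForm_eq Filter.EventuallyEq.rfl (fun _ _ => rfl) hq' hq, hinner,
      inner_toL2 fun _ _ => rfl, ← h, Complex.ofReal_neg, neg_mul, ← sub_eq_add_neg]
  · rintro ⟨q, hq, h⟩
    have hq0 := (mem_meanZeroPerSpace (q := (q : PerSpace M (2 * Real.pi))) fun _ _ => rfl).1 q.2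
    refine ⟨_, _, isPerH1 (q : PerSpace M (2 * Real.pi)), ?_, fun v v' hv hv0 => ?_⟩
    · rw [hq]; exact coeFn_toL2 (q : PerSpace M (2 * Real.pi))
    · rw [meanFree_eq_self hv0, meanFree_eq_self hq0]
      refine ⟨integrable_inner_matApply hVm hV hVi (isPerH1 _) hv, ?_⟩
      obtain ⟨r, hr', hr⟩ := exists_of_isPerH1 hL hv
      have h1 := h ⟨r, (mem_meanZeroPerSpace hr).2 hv0⟩
      rw [hinner, inner_toL2 hr, schrForm_eq hr' hr Filter.EventuallyEq.rfl (fun _ _ => rfl)] at h1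
      rw [← h1, Complex.ofReal_neg, neg_mul, ← sub_eq_add_neg]

lemma schrOp2_spectrum {δ : ℝ} (hδ0 : 0 ≤ δ) (hδ : δ < 1)
    (hVm : AEStronglyMeasurable V (perMeasure (2 * Real.pi)))
    (hV : ∀ᵐ x ∂perMeasure (2 * Real.pi), (V x).PosSemidef)
    (hVi : Integrable (fun x => traceRpow (V x)) (perMeasure (2 * Real.pi))) :
    HasDiscreteSpectrum (schrOp2 δ V) ∧ negEigenvalueSum (schrOp2 δ V) ≤
      ENNReal.ofReal (2 / (3 * Real.sqrt 3) * sharpK2 δ *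
        ∫ x, traceRpow (V x) ∂perMeasure (2 * Real.pi)) := by
  obtain ⟨hK0, hK⟩ := sharpK2_spec hδ0 hδ
  obtain ⟨l, d, hd, hcoer⟩ := exists_coercive (c := -δ) (hVm := hVm) (hV := hV) (hVi := hVi)
    (show 0 < 2 * Real.pi by positivity)
  have hcoer' : ∃ l d : ℝ, 0 < d ∧ ∀ u, d * ‖u‖ ^ 2 ≤
      (meanZeroForm δ hVm hV hVi u u).re + l * ‖toMeanZeroL2 M u‖ ^ 2 :=
    ⟨l, d, hd, fun u => hcoer u⟩
  have hconj : ∀ u v, meanZeroForm δ hVm hV hVi v u =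
      starRingEnd ℂ (meanZeroForm δ hVm hV hVi u v) := fun u v => schrForm_conj _ _
  have hG := mem_graph_schrOp2_iff (δ := δ) hVm hV hVi
  refine hasDiscreteSpectrum_and_negEigenvalueSum_le isCompactOperator_toMeanZeroL2 _ hconj hcoer'
    hG fun ι _ q e hon he => ?_
  refine sum_neg_le hK0 hK (fun u u' hu hu0 => ?_)
    (fun i => (q i : PerSpace M (2 * Real.pi))) e (fun _ i => (q i).2)
    (hon.comp_linearIsometry (MeanZeroL2 M).subtypeₗᵢ) he
  have h1 : 0 ≤ ∫ t, ‖u t‖ ^ 2 ∂perMeasure (2 * Real.pi) :=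
    integral_nonneg fun t => by positivity
  -- Wirtinger and `δ < 1` make the energy nonnegative on mean-zero functions.
  have h2 := hu.wirtinger (hu0 trivial)
  nlinarith

end

end

theorem mainTheorem5 (M : ℕ) :
    (∀ (α β : ℝ), 0 < α → 0 < β → ∀ V : ℝ → Matrix (Fin M) (Fin M) ℂ,
      AEStronglyMeasurable V (perMeasure (2 * Real.pi / α)) →
      (∀ᵐ x ∂perMeasure (2 * Real.pi / α), (V x).PosSemidef) →
      Integrable (fun x => traceRpow (V x)) (perMeasure (2 * Real.pi / α)) →
      HasDiscreteSpectrum (schrOp1 α β V) ∧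
      negEigenvalueSum (schrOp1 α β V) ≤
        ENNReal.ofReal (2 / (3 * Real.sqrt 3) * sharpK1 β *
          ∫ x, traceRpow (V x) ∂perMeasure (2 * Real.pi / α))) ∧
    (∀ δ : ℝ, 0 ≤ δ → δ < 1 → ∀ V : ℝ → Matrix (Fin M) (Fin M) ℂ,
      AEStronglyMeasurable V (perMeasure (2 * Real.pi)) →
      (∀ᵐ x ∂perMeasure (2 * Real.pi), (V x).PosSemidef) →
      Integrable (fun x => traceRpow (V x)) (perMeasure (2 * Real.pi)) →
      HasDiscreteSpectrum (schrOp2 δ V) ∧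
      negEigenvalueSum (schrOp2 δ V) ≤
        ENNReal.ofReal (2 / (3 * Real.sqrt 3) * sharpK2 δ *
          ∫ x, traceRpow (V x) ∂perMeasure (2 * Real.pi))) :=
  ⟨fun _ _ hα hβ _ hVm hV hVi => schrOp1_spectrum hα hβ hVm hV hVi,
    fun _ hδ0 hδ _ hVm hV hVi => schrOp2_spectrum hδ0 hδ hVm hV hVi⟩
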